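/- **Theorem.** Let $n$ be a positive integer with $n\notin\{1,2,3,4,5,6,8,10,12\}$, let $\Psi_n(x)$ be the minimal polynomial over $\mathbb Q$ of $2\cos(2\pi/n)$, and let $\Psi_n(x,y)=y^{\deg \Psi_n}\Psi_n(x/y)$ be its homogenization. For a binary form $F$ with rational coefficients and a rational matrix $M=\begin{pmatrix}s&u\\t&v\end{pmatrix}$ put $F_M(x,y)=F(sx+uy,\,tx+vy)$. Let $\operatorname{Aut}F$ be the set of all rational $2\times2$ matrices $M$ with $F_M=F$, and let $\operatorname{Aut}|F|$ be the set of all rational $2\times 2$ matrices $M$ with $F_M=F$ or $F_M=-F$. Write $\langle\cdots\rangle$ for the subgroup of $\mathrm{GL}_2(\mathbb Q)$ generated by the listed matrices, $I$ for the $2\times2$ identity matrix, and $$\mathbf C_1=\langle I\rangle,\quad \mathbf C_2=\langle -I\rangle,\quad \mathbf C_3=\left\langle\begin{pmatrix}0&1\\-1&-1\end{pmatrix}\right\rangle,\quad \mathbf C_4=\left\langle\begin{pmatrix}0&1\\-1&0\end{pmatrix}\right\rangle,\quad \mathbf C_6=\left\langle\begin{pmatrix}0&-1\\1&1\end{pmatrix}\right\rangle,$$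 $$\mathbf D_2=\left\langle\begin{pmatrix}0&1\\1&0\end{pmatrix},-I\right\rangle,\quad \mathbf D_4=\left\langle\begin{pmatrix}0&1\\1&0\end{pmatrix},\begin{pmatrix}0&1\\-1&0\end{pmatrix}\right\rangle.$$ Write $G\cong H$ if $G$ and $H$ are conjugate in $\mathrm{GL}_2(\mathbb Q)$ (so in particular isomorphic). Let $d=\varphi(n)/2$. Then $\deg\Psi_n=d\ge 3$, and the following hold. 1. If $d\ge5$ is odd, then $\operatorname{Aut}\Psi_n=\{I\}\cong\mathbf C_1$ and $\operatorname{Aut}|\Psi_n|=\{\pm I\}\cong\mathbf C_2$. 2. If $d\ge6$ is even and $4\nmid n$, then $\operatorname{Aut}\Psi_n=\operatorname{Aut}|\Psi_n|=\{\pm I\}\cong\mathbf C_2$. 3. If $4\mid n$ and $n\ne24$, then $$\operatorname{Aut}\Psi_n=\operatorname{Aut}|\Psi_n|=\left\langle\begin{pmatrix}-1&0\\0&1\end{pmatrix},\begin{pmatrix}1&0\\0&-1\end{pmatrix}\right\rangle\cong\mathbf D_2 .$$ 4. For $n\in\{7,9,14,15,18,24,30\}$: - if $n\in\{7,18\}$,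 then $\operatorname{Aut}\Psi_n=\left\langle\begin{pmatrix}-1&-1\\1&0\end{pmatrix}\right\rangle\cong\mathbf C_3$ and $\operatorname{Aut}|\Psi_n|=\left\langle\begin{pmatrix}-1&-1\\1&0\end{pmatrix},-I\right\rangle\cong\mathbf C_6$; - if $n\in\{9,14\}$, then $\operatorname{Aut}\Psi_n=\left\langle\begin{pmatrix}-1&1\\-1&0\end{pmatrix}\right\rangle\cong\mathbf C_3$ and $\operatorname{Aut}|\Psi_n|=\left\langle\begin{pmatrix}-1&1\\-1&0\end{pmatrix},-I\right\rangle\cong\mathbf C_6$; - if $n=15$, then $\operatorname{Aut}\Psi_n=\operatorname{Aut}|\Psi_n|=\left\langle\begin{pmatrix}-1&2\\-1&1\end{pmatrix}\right\rangle\cong\mathbf C_4$; - if $n=24$, then $\operatorname{Aut}\Psi_n=\operatorname{Aut}|\Psi_n|=\left\langle\begin{pmatrix}0&1\\1&0\end{pmatrix},\begin{pmatrix}0&1\\-1&0\end{pmatrix}\right\rangle=\mathbf D_4$; - if $n=30$, then $\operatorname{Aut}\Psi_n=\operatorname{Aut}|\Psi_n|=\left\langle\begin{pmatrix}1&2\\-1&-1\end{pmatrix}\right\rangle\cong\mathbf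 C_4$. -/

import Mathlib

/-- The polynomial `Ψ_n(x)`: the minimal polynomial of `2 cos (2π / n)` over `ℚ`. -/
noncomputable def psiPoly (n : ℕ) : Polynomial ℚ :=
  minpoly ℚ (2 * Real.cos (2 * Real.pi / (n : ℝ)))

/-- The binary form `Ψ_n(x, y) = y ^ d * Ψ_n(x / y)`, where `d` is the degree of `Ψ_n(x)`;
the variable `x` is `X 0` and the variable `y` is `X 1`. -/
noncomputable def psiForm (n : ℕ) : MvPolynomial (Fin 2) ℚ :=
  (psiPoly n).homogenize (psiPoly n).natDegree

/-- For `M = !![s, u; t, v]`, the form `F_M(x, y) = F(s x + u y, t x + v y)`. -/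
noncomputable def formSubst (F : MvPolynomial (Fin 2) ℚ) (M : Matrix (Fin 2) (Fin 2) ℚ) :
    MvPolynomial (Fin 2) ℚ :=
  MvPolynomial.bind₁ (fun i : Fin 2 =>
    MvPolynomial.C (M i 0) * MvPolynomial.X 0 + MvPolynomial.C (M i 1) * MvPolynomial.X 1) F

/-- `Aut F`: all rational `2 × 2` matrices `M` with `F_M = F`. -/
def formAut (F : MvPolynomial (Fin 2) ℚ) : Set (Matrix (Fin 2) (Fin 2) ℚ) :=
  {M | formSubst F M = F}

/-- `Aut |F|`: all rational `2 × 2` matrices `M` with `F_M = F` or `F_M = -F`. -/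
def formAutAbs (F : MvPolynomial (Fin 2) ℚ) : Set (Matrix (Fin 2) (Fin 2) ℚ) :=
  {M | formSubst F M = F ∨ formSubst F M = -F}

/-- The subgroup of `GL₂(ℚ)` generated by a set `S` of (invertible) matrices, as a set of
matrices. -/
def matrixGroup (S : Set (Matrix (Fin 2) (Fin 2) ℚ)) : Set (Matrix (Fin 2) (Fin 2) ℚ) :=
  (fun g : GL (Fin 2) ℚ => (g : Matrix (Fin 2) (Fin 2) ℚ)) ''
    (Subgroup.closure {g : GL (Fin 2) ℚ | (g : Matrix (Fin 2) (Fin 2) ℚ) ∈ S} :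
      Set (GL (Fin 2) ℚ))

/-- `H` and `K` are conjugate in `GL₂(ℚ)`, that is, `H = g K g⁻¹` for some `g` in `GL₂(ℚ)`.
If `H` and `K` are matrix groups, conjugation by `g` is an isomorphism of groups. -/
def GLConjugate (H K : Set (Matrix (Fin 2) (Fin 2) ℚ)) : Prop :=
  ∃ g : GL (Fin 2) ℚ, H = (fun M => (g : Matrix (Fin 2) (Fin 2) ℚ) * M *
    ((g⁻¹ : GL (Fin 2) ℚ) : Matrix (Fin 2) (Fin 2) ℚ)) '' K

/-- The trivial group. -/
def groupC1 : Set (Matrix (Fin 2) (Fin 2) ℚ) := matrixGroup {!![1, 0; 0, 1]}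

/-- The standard cyclic group of order `2`, generated by `-I`. -/
def groupC2 : Set (Matrix (Fin 2) (Fin 2) ℚ) := matrixGroup {!![-1, 0; 0, -1]}

/-- The standard cyclic group of order `3`. -/
def groupC3 : Set (Matrix (Fin 2) (Fin 2) ℚ) := matrixGroup {!![0, 1; -1, -1]}

/-- The standard cyclic group of order `4`. -/
def groupC4 : Set (Matrix (Fin 2) (Fin 2) ℚ) := matrixGroup {!![0, 1; -1, 0]}

/-- The standard cyclic group of order `6`. -/
def groupC6 : Set (Matrix (Fin 2) (Fin 2) ℚ) := matrixGroup {!![0, -1; 1, 1]}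

/-- The standard dihedral group of order `4`. -/
def groupD2 : Set (Matrix (Fin 2) (Fin 2) ℚ) :=
  matrixGroup {!![0, 1; 1, 0], !![-1, 0; 0, -1]}

/-- The standard dihedral group of order `8`. -/
def groupD4 : Set (Matrix (Fin 2) (Fin 2) ℚ) :=
  matrixGroup {!![0, 1; 1, 0], !![0, 1; -1, 0]}

theorem Nat.le_two_mul_totient_sq (n : ℕ) :
    (Odd n → n ≤ n.totient ^ 2) ∧ n ≤ 2 * n.totient ^ 2 := by
  induction n using Nat.recOnPosPrimePosCoprime with
  | zero => simp
  | one => simp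
  | prime_pow p k hp hk =>
    obtain ⟨j, rfl⟩ : ∃ j, k = j + 1 := ⟨k - 1, by omega⟩
    rw [Nat.totient_prime_pow_succ hp]
    have h1 : 1 ≤ p ^ j := Nat.one_le_pow _ _ hp.pos
    rcases hp.eq_two_or_odd' with rfl | hodd
    · refine ⟨fun h => ?_, ?_⟩
      · exact absurd h (by simp [Nat.even_pow])
      · rw [pow_succ]
        nlinarith
    · have h3 : 3 ≤ p := by
        have := hp.two_le
        obtain ⟨m, rfl⟩ := hodd
        omega
      obtain ⟨q, rfl⟩ : ∃ q, p = q + 3 := ⟨p - 3, by omega⟩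
      have key : (q + 3) ^ (j + 1) ≤ ((q + 3) ^ j * (q + 3 - 1)) ^ 2 := by
        have h2 : q + 3 - 1 = q + 2 := by omega
        rw [h2, pow_succ]
        generalize (q + 3) ^ j = x at *
        have : q + 3 ≤ (q + 2) ^ 2 := by nlinarith
        calc x * (q + 3) ≤ x * (q + 2) ^ 2 := Nat.mul_le_mul_left _ this
          _ ≤ x ^ 2 * (q + 2) ^ 2 := Nat.mul_le_mul_right _ (by nlinarith)
          _ = _ := by ring
      exact ⟨fun _ => key, by omega⟩
  | coprime a b ha hb hab iha ihb =>
    rw [Nat.totient_mul hab, mul_pow]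
    refine ⟨fun h => ?_, ?_⟩
    · rw [Nat.odd_mul] at h
      exact Nat.mul_le_mul (iha.1 h.1) (ihb.1 h.2)
    · rcases Nat.even_or_odd a with hae | hao
      · have hbo : Odd b := by
          rw [← Nat.not_even_iff_odd]
          intro hbe
          have := Nat.dvd_gcd hae.two_dvd hbe.two_dvd
          rw [hab] at this
          omega
        calc a * b ≤ (2 * a.totient ^ 2) * b.totient ^ 2 := Nat.mul_le_mul iha.2 (ihb.1 hbo)
          _ = _ := by ring
      · calc a * b ≤ a.totient ^ 2 * (2 * b.totient ^ 2) := Nat.mul_le_mul (iha.1 hao) ihb.2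
          _ = _ := by ring

theorem Nat.three_le_totient_div_two {n : ℕ} (hn : 0 < n)
    (h : n ∉ ({1, 2, 3, 4, 5, 6, 8, 10, 12} : Set ℕ)) : 3 ≤ n.totient / 2 := by
  by_contra hc
  have h5 : n.totient ≤ 5 := by omega
  have hb : n ≤ 50 := (Nat.le_two_mul_totient_sq n).2.trans (by nlinarith)
  have key : ∀ m < 51, m.totient ≤ 5 →
      m ∈ ({0, 1, 2, 3, 4, 5, 6, 8, 10, 12} : Finset ℕ) := by
    decide
  have := key n (by omega) h5
  simp only [Finset.mem_insert, Finset.mem_singleton] at this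
  simp only [Set.mem_insert_iff, Set.mem_singleton_iff] at h
  omega

set_option maxRecDepth 4000 in
theorem Nat.eq_of_totient_div_two_eq_four {n : ℕ} (h4 : 4 ∣ n) (h : n.totient / 2 = 4) :
    n = 16 ∨ n = 20 ∨ n = 24 := by
  have h5 : n.totient ≤ 9 := by omega
  have hb : n ≤ 162 := (Nat.le_two_mul_totient_sq n).2.trans (by nlinarith)
  obtain ⟨m, rfl⟩ := h4
  have key : ∀ m < 41, (4 * m).totient / 2 = 4 → 4 * m = 16 ∨ 4 * m = 20 ∨ 4 * m = 24 := by
    decide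
  exact key m (by omega) h

theorem Nat.even_totient_div_two {n : ℕ} (h4 : 4 ∣ n) (hn : 4 < n) : Even (n.totient / 2) := by
  obtain ⟨m, rfl⟩ := h4
  have h : 4 * m = 2 * (2 * m) := by ring
  rw [h, Nat.totient_two_mul_of_even (even_two_mul m), Nat.mul_div_cancel_left _ (by norm_num)]
  exact Nat.totient_even (by omega)

section Cyclotomic

variable {n : ℕ} [NeZero n] {K : Type*} [Field K] [NumberField K]
  [IsCyclotomicExtension {n} ℚ K] {ζ : K}

theorem IsPrimitiveRoot.exists_algEquiv_eq_pow (hζ : IsPrimitiveRoot ζ n) {a : ℕ}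
    (ha : a.Coprime n) : ∃ σ : K ≃ₐ[ℚ] K, σ ζ = ζ ^ a := by
  have hirr : Irreducible (Polynomial.cyclotomic n ℚ) :=
    Polynomial.cyclotomic.irreducible_rat (NeZero.pos n)
  have := IsCyclotomicExtension.isGalois {n} ℚ K
  refine minpoly.exists_algEquiv_of_root' (Algebra.IsAlgebraic.isAlgebraic ζ) ?_
  have h : minpoly ℚ ζ = minpoly ℚ (ζ ^ a) := by
    rw [← hζ.minpoly_eq_cyclotomic_of_irreducible hirr,
      ← (hζ.pow_of_coprime a ha).minpoly_eq_cyclotomic_of_irreducible hirr]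
  rw [h]
  exact minpoly.aeval _ _

theorem IsPrimitiveRoot.algEquiv_ext (hζ : IsPrimitiveRoot ζ n) {σ τ : K ≃ₐ[ℚ] K}
    (h : σ ζ = τ ζ) : σ = τ := by
  have : σ.toAlgHom = τ.toAlgHom := by
    apply (hζ.powerBasis ℚ).algHom_ext
    simpa using h
  exact AlgEquiv.coe_toAlgHom_injective this

theorem IsPrimitiveRoot.algEquiv_comm (hζ : IsPrimitiveRoot ζ n) (σ τ : K ≃ₐ[ℚ] K) (x : K) :
    σ (τ x) = τ (σ x) := by
  have hpow : ∀ ρ : K ≃ₐ[ℚ] K, ∃ i : ℕ, ρ ζ = ζ ^ i := fun ρ => by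
    obtain ⟨i, -, hi⟩ := hζ.eq_pow_of_pow_eq_one (ξ := ρ ζ) (by
      rw [← map_pow, hζ.pow_eq_one, map_one])
    exact ⟨i, hi.symm⟩
  have : σ * τ = τ * σ := hζ.algEquiv_ext (by
    obtain ⟨i, hi⟩ := hpow σ
    obtain ⟨j, hj⟩ := hpow τ
    rw [AlgEquiv.mul_apply, AlgEquiv.mul_apply, hi, hj, map_pow, map_pow, hi, hj, ← pow_mul,
      ← pow_mul, mul_comm])
  exact DFunLike.congr_fun this x

theorem psiPoly_eq_minpoly (hζ : IsPrimitiveRoot ζ n) : psiPoly n = minpoly ℚ (ζ + ζ⁻¹) := by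
  have hirr : Irreducible (Polynomial.cyclotomic n ℚ) :=
    Polynomial.cyclotomic.irreducible_rat (NeZero.pos n)
  have hn : n ≠ 0 := NeZero.ne n
  set η : ℂ := Complex.exp (2 * Real.pi * Complex.I / n) with hη
  have hηp : IsPrimitiveRoot η n := Complex.isPrimitiveRoot_exp n hn
  obtain ⟨f, hf⟩ : ∃ f : K →ₐ[ℚ] ℂ, f ζ = η := by
    refine ⟨(hζ.powerBasis ℚ).lift η ?_, ?_⟩
    · rw [IsPrimitiveRoot.powerBasis_gen, ← hζ.minpoly_eq_cyclotomic_of_irreducible hirr,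
        Polynomial.cyclotomic_eq_minpoly_rat hηp (NeZero.pos n)]
      exact minpoly.aeval _ _
    · have := (hζ.powerBasis ℚ).lift_gen η (by
        rw [IsPrimitiveRoot.powerBasis_gen, ← hζ.minpoly_eq_cyclotomic_of_irreducible hirr,
        Polynomial.cyclotomic_eq_minpoly_rat hηp (NeZero.pos n)]
        exact minpoly.aeval _ _)
      simpa using this
  have h1 : minpoly ℚ (f (ζ + ζ⁻¹)) = minpoly ℚ (ζ + ζ⁻¹) :=
    minpoly.algHom_eq f f.injective _
  have h2 : f (ζ + ζ⁻¹) = algebraMap ℝ ℂ (2 * Real.cos (2 * Real.pi / n)) := by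
    rw [map_add, map_inv₀, hf, hη, ← Complex.exp_neg, Complex.coe_algebraMap]
    push_cast
    rw [Complex.cos]
    ring_nf
  rw [← h1, h2, minpoly.algebraMap_eq (algebraMap ℝ ℂ).injective]
  rfl

theorem IsPrimitiveRoot.natDegree_minpoly_add_inv (hζ : IsPrimitiveRoot ζ n) (hn : 2 < n) :
    (minpoly ℚ (ζ + ζ⁻¹)).natDegree = n.totient / 2 := by
  have hirr : Irreducible (Polynomial.cyclotomic n ℚ) :=
    Polynomial.cyclotomic.irreducible_rat (NeZero.pos n)
  have := IsCyclotomicExtension.isGalois {n} ℚ K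
  have hζ0 : ζ ≠ 0 := hζ.ne_zero (NeZero.ne n)
  obtain ⟨σ, hσ⟩ := hζ.exists_algEquiv_eq_pow (a := n - 1) (by
    rw [Nat.coprime_comm, Nat.coprime_self_sub_right (by omega)]
    exact Nat.coprime_one_right n)
  have hσ' : σ ζ = ζ⁻¹ := by
    rw [hσ]
    refine eq_inv_of_mul_eq_one_left ?_
    rw [← pow_succ, Nat.sub_add_cancel (by omega), hζ.pow_eq_one]
  have hne : σ ≠ 1 := by
    intro h
    rw [h, AlgEquiv.one_apply] at hσ'
    have : ζ ^ 2 = 1 := by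
      rw [pow_two]
      nth_rewrite 2 [hσ']
      exact mul_inv_cancel₀ hζ0
    have := Nat.le_of_dvd (by norm_num) (hζ.dvd_of_pow_eq_one 2 this)
    omega
  have hfix : (IntermediateField.fixingSubgroup (IntermediateField.adjoin ℚ {ζ + ζ⁻¹}) :
      Set (K ≃ₐ[ℚ] K)) = {1, σ} := by
    ext τ
    have hmem : τ ∈ IntermediateField.fixingSubgroup (IntermediateField.adjoin ℚ {ζ + ζ⁻¹}) ↔
        τ (ζ + ζ⁻¹) = ζ + ζ⁻¹ := by
      rw [IntermediateField.mem_fixingSubgroup_iff]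
      constructor
      · intro h
        exact h _ (IntermediateField.mem_adjoin_simple_self ℚ _)
      · intro h x hx
        induction hx using IntermediateField.adjoin_induction with
        | mem x hx => rw [Set.mem_singleton_iff.1 hx, h]
        | algebraMap x => exact τ.commutes x
        | add x y _ _ hx hy => rw [map_add, hx, hy]
        | inv x _ hx => rw [map_inv₀, hx]
        | mul x y _ _ hx hy => rw [map_mul, hx, hy]
    rw [SetLike.mem_coe, hmem, Set.mem_insert_iff, Set.mem_singleton_iff]
    constructor
    · intro h
      have hτ0 : τ ζ ≠ 0 := by simpa using hζ0
      rw [map_add, map_inv₀] at h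
      have h' : (τ ζ - ζ) * (τ ζ * ζ - 1) = 0 := by
        field_simp at h
        linear_combination h
      rcases mul_eq_zero.1 h' with h' | h'
      · exact Or.inl (hζ.algEquiv_ext (by rw [AlgEquiv.one_apply]; exact sub_eq_zero.1 h'))
      · exact Or.inr (hζ.algEquiv_ext (by
          rw [hσ']; exact eq_inv_of_mul_eq_one_left (sub_eq_zero.1 h')))
    · rintro (rfl | rfl)
      · rfl
      · rw [map_add, map_inv₀, hσ', inv_inv, add_comm]
  have hcard := IsGalois.card_fixingSubgroup_eq_finrank
    (IntermediateField.adjoin ℚ {ζ + ζ⁻¹} : IntermediateField ℚ K)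
  have h2 : Nat.card (IntermediateField.fixingSubgroup
      (IntermediateField.adjoin ℚ {ζ + ζ⁻¹} : IntermediateField ℚ K)) = 2 := by
    have : Set.ncard ({1, σ} : Set (K ≃ₐ[ℚ] K)) = 2 := Set.ncard_pair hne.symm
    rw [← hfix] at this
    exact this
  have hmul := Module.finrank_mul_finrank ℚ
    (IntermediateField.adjoin ℚ {ζ + ζ⁻¹} : IntermediateField ℚ K) K
  rw [← hcard, h2, IntermediateField.adjoin.finrank (Algebra.IsIntegral.isIntegral _),
    IsCyclotomicExtension.finrank K hirr] at hmul
  omega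

end Cyclotomic

theorem minpoly_eq_zero_of_aeval {K : Type*} [Field K] [Algebra ℚ K] {α : K} {q : Polynomial ℚ}
    (hq : Polynomial.aeval α q = 0) (hdeg : q.natDegree < (minpoly ℚ α).natDegree) : q = 0 := by
  by_contra h
  exact absurd (Polynomial.natDegree_le_natDegree (minpoly.degree_le_of_ne_zero ℚ α h hq))
    (not_le.2 hdeg)

theorem quadratic_coeffs_eq_zero {K : Type*} [Field K] [Algebra ℚ K] {α : K}
    (hdeg : 3 ≤ (minpoly ℚ α).natDegree) {a b c : ℚ}
    (h : algebraMap ℚ K a * α ^ 2 + algebraMap ℚ K b * α + algebraMap ℚ K c = 0) :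
    a = 0 ∧ b = 0 ∧ c = 0 := by
  open Polynomial in
  have hq : (C a * X ^ 2 + C b * X + C c : ℚ[X]) = 0 := by
    refine minpoly_eq_zero_of_aeval (α := α) (by simpa using h) (lt_of_le_of_lt ?_ hdeg)
    compute_degree
  refine ⟨?_, ?_, ?_⟩
  · simpa using
      congrArg (fun p => Polynomial.coeff p 2) hq
  · simpa using
      congrArg (fun p => Polynomial.coeff p 1) hq
  · simpa using
      congrArg (fun p => Polynomial.coeff p 0) hq

theorem quartic_coeffs_eq_zero {K : Type*} [Field K] [Algebra ℚ K] {α : K}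
    (hdeg : 5 ≤ (minpoly ℚ α).natDegree) {a b c e f : ℚ}
    (h : algebraMap ℚ K a * α ^ 4 + algebraMap ℚ K b * α ^ 3 + algebraMap ℚ K c * α ^ 2 +
      algebraMap ℚ K e * α + algebraMap ℚ K f = 0) :
    a = 0 ∧ b = 0 ∧ c = 0 ∧ e = 0 ∧ f = 0 := by
  open Polynomial in
  have hq : (C a * X ^ 4 + C b * X ^ 3 + C c * X ^ 2 + C e * X + C f : ℚ[X]) = 0 := by
    refine minpoly_eq_zero_of_aeval (α := α) (by simpa using h) (lt_of_le_of_lt ?_ hdeg)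
    compute_degree
  refine ⟨?_, ?_, ?_, ?_, ?_⟩
  · simpa [Polynomial.coeff_X, Polynomial.coeff_C] using
      congrArg (fun p => Polynomial.coeff p 4) hq
  · simpa [Polynomial.coeff_X, Polynomial.coeff_C] using
      congrArg (fun p => Polynomial.coeff p 3) hq
  · simpa [Polynomial.coeff_X, Polynomial.coeff_C] using
      congrArg (fun p => Polynomial.coeff p 2) hq
  · simpa [Polynomial.coeff_X, Polynomial.coeff_C] using
      congrArg (fun p => Polynomial.coeff p 1) hq
  · simpa [Polynomial.coeff_X, Polynomial.coeff_C] using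
      congrArg (fun p => Polynomial.coeff p 0) hq

section Forms

variable {A : Type*} [Field A] [Algebra ℚ A]

theorem aeval_formSubst (F : MvPolynomial (Fin 2) ℚ) (M : Matrix (Fin 2) (Fin 2) ℚ) (x y : A) :
    MvPolynomial.aeval ![x, y] (formSubst F M) =
      MvPolynomial.aeval ![algebraMap ℚ A (M 0 0) * x + algebraMap ℚ A (M 0 1) * y,
        algebraMap ℚ A (M 1 0) * x + algebraMap ℚ A (M 1 1) * y] F := by
  rw [formSubst, MvPolynomial.aeval_bind₁]
  congr 1
  apply congrArg
  funext i
  fin_cases i <;> simp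

theorem MvPolynomial.IsHomogeneous.aeval_mul_pair {F : MvPolynomial (Fin 2) ℚ} {d : ℕ}
    (hF : F.IsHomogeneous d) (c x y : A) :
    MvPolynomial.aeval ![c * x, c * y] F = c ^ d * MvPolynomial.aeval ![x, y] F := by
  have : (![c * x, c * y] : Fin 2 → A) = fun i => c * ![x, y] i := by
    funext i
    fin_cases i <;> simp
  rw [this]
  simp only [MvPolynomial.aeval_def]
  rw [MvPolynomial.eval₂_eq', MvPolynomial.eval₂_eq', Finset.mul_sum]
  refine Finset.sum_congr rfl fun m hm => ?_
  have hd := hF (MvPolynomial.mem_support_iff.1 hm)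
  rw [Finsupp.weight_apply, Finsupp.sum_fintype _ _ (by simp)] at hd
  simp only [Fin.sum_univ_two, Fin.prod_univ_two, Pi.one_apply, smul_eq_mul, mul_one] at hd ⊢
  rw [← hd]
  ring

theorem aeval_homogenize_pair {p : Polynomial ℚ} (x : A) {y : A} (hy : y ≠ 0) :
    MvPolynomial.aeval ![x, y] (p.homogenize p.natDegree) =
      y ^ p.natDegree * Polynomial.aeval (x / y) p := by
  have h := (Polynomial.isHomogeneous_homogenize (n := p.natDegree) p).aeval_mul_pair y (x / y) 1
  rw [mul_div_cancel₀ _ hy, mul_one] at h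
  rw [h, Polynomial.aeval_homogenize_of_eq_one le_rfl _ (by simp)]
  simp

theorem aeval_homogenize_pair_zero {p : Polynomial ℚ} (hp : p.Monic) (x : A) :
    MvPolynomial.aeval ![x, 0] (p.homogenize p.natDegree) = x ^ p.natDegree := by
  rw [Polynomial.homogenize, map_sum, Finset.sum_eq_single (p.natDegree, 0)]
  · simp [MvPolynomial.aeval_monomial, Finsupp.prod_fintype, hp.coeff_natDegree]
  · rintro ⟨i, j⟩ hij hne
    rw [Finset.HasAntidiagonal.mem_antidiagonal] at hij
    have hj : j ≠ 0 := by
      rintro rfl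
      exact hne (by simpa using hij)
    simp [MvPolynomial.aeval_monomial, Finsupp.prod_fintype, hj]
  · simp

theorem formSubst_eq_iff {F G : MvPolynomial (Fin 2) ℚ} {M : Matrix (Fin 2) (Fin 2) ℚ} :
    formSubst F M = G ↔ ∀ x y : ℚ, MvPolynomial.aeval ![M 0 0 * x + M 0 1 * y,
        M 1 0 * x + M 1 1 * y] F = MvPolynomial.aeval ![x, y] G := by
  constructor
  · rintro rfl x y
    rw [aeval_formSubst]
    simp
  · intro h
    apply MvPolynomial.funext
    intro z
    have hz : z = ![z 0, z 1] := by
      funext i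
      fin_cases i <;> rfl
    have h1 := h (z 0) (z 1)
    have h2 := aeval_formSubst F M (z 0) (z 1)
    simp only [Algebra.algebraMap_self, RingHom.id_apply] at h2
    rw [h1, MvPolynomial.aeval_eq_eval, ← hz] at h2
    exact h2

theorem mem_formAutAbs_aeval {F : MvPolynomial (Fin 2) ℚ} {M : Matrix (Fin 2) (Fin 2) ℚ}
    (hM : M ∈ formAutAbs F) (x y : A) :
    MvPolynomial.aeval ![algebraMap ℚ A (M 0 0) * x + algebraMap ℚ A (M 0 1) * y,
        algebraMap ℚ A (M 1 0) * x + algebraMap ℚ A (M 1 1) * y] F = MvPolynomial.aeval ![x, y] F ∨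
    MvPolynomial.aeval ![algebraMap ℚ A (M 0 0) * x + algebraMap ℚ A (M 0 1) * y,
        algebraMap ℚ A (M 1 0) * x + algebraMap ℚ A (M 1 1) * y] F =
          -MvPolynomial.aeval ![x, y] F := by
  rw [← aeval_formSubst]
  rcases hM with h | h
  · exact Or.inl (by rw [h])
  · exact Or.inr (by rw [h, map_neg])

theorem formAut_subset_formAutAbs (F : MvPolynomial (Fin 2) ℚ) : formAut F ⊆ formAutAbs F :=
  fun _ h => Or.inl h

theorem one_mem_formAut (F : MvPolynomial (Fin 2) ℚ) :
    (1 : Matrix (Fin 2) (Fin 2) ℚ) ∈ formAut F := by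
  refine formSubst_eq_iff.2 fun x y => ?_
  simp

theorem MvPolynomial.IsHomogeneous.formSubst_neg {F : MvPolynomial (Fin 2) ℚ} {d : ℕ}
    (hF : F.IsHomogeneous d) (M : Matrix (Fin 2) (Fin 2) ℚ) :
    formSubst F (-M) = (-1) ^ d * formSubst F M := by
  refine formSubst_eq_iff.2 fun x y => ?_
  have h := hF.aeval_mul_pair (-1 : ℚ) (M 0 0 * x + M 0 1 * y) (M 1 0 * x + M 1 1 * y)
  rw [map_mul, map_pow, map_neg, map_one, (formSubst_eq_iff.1 (rfl : formSubst F M = _) x y).symm,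
    ← h]
  simp only [Matrix.neg_apply]
  ring_nf

end Forms

theorem eq_one_or_eq_neg_one_of_pow {s : ℚ} {d : ℕ} (hd : d ≠ 0) (h : s ^ d = 1 ∨ s ^ d = -1) :
    s = 1 ∨ s = -1 := by
  have h1 : (s ^ 2) ^ d = 1 := by
    rw [← pow_mul, mul_comm, pow_mul]
    rcases h with h | h <;> rw [h] <;> norm_num
  exact sq_eq_one_iff.1 ((pow_eq_one_iff_of_nonneg (sq_nonneg s) hd).1 h1)

section Roots

variable {K : Type*} [Field K] [NumberField K] {α : K}

theorem algebraMap_ne_of_aeval_minpoly (hdeg : 3 ≤ (minpoly ℚ α).natDegree) {β : K}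
    (hβ : Polynomial.aeval β (minpoly ℚ α) = 0) (q : ℚ) : β ≠ algebraMap ℚ K q := by
  rintro rfl
  have h := minpoly.eq_of_irreducible_of_monic
    (minpoly.irreducible (Algebra.IsIntegral.isIntegral (R := ℚ) α)) hβ
    (minpoly.monic (Algebra.IsIntegral.isIntegral α))
  rw [h, minpoly.eq_X_sub_C K q, Polynomial.natDegree_X_sub_C] at hdeg
  omega

theorem linear_coeffs_eq_zero (hdeg : 3 ≤ (minpoly ℚ α).natDegree) {b c : ℚ}
    (h : algebraMap ℚ K b * α + algebraMap ℚ K c = 0) : b = 0 ∧ c = 0 :=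
  (quadratic_coeffs_eq_zero (α := α) hdeg (a := 0) (by simpa using h)).2

/-- An automorphism of the form attached to `minpoly ℚ α` is nonsingular, and the corresponding
Möbius transformation maps `α` to one of its conjugates. -/
theorem exists_root_of_mem_formAutAbs (hdeg : 3 ≤ (minpoly ℚ α).natDegree)
    {M : Matrix (Fin 2) (Fin 2) ℚ}
    (hM : M ∈ formAutAbs ((minpoly ℚ α).homogenize (minpoly ℚ α).natDegree)) :
    M 0 0 * M 1 1 - M 0 1 * M 1 0 ≠ 0 ∧ ∃ β : K, Polynomial.aeval β (minpoly ℚ α) = 0 ∧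
      (algebraMap ℚ K (M 1 0) * α + algebraMap ℚ K (M 1 1)) * β =
        algebraMap ℚ K (M 0 0) * α + algebraMap ℚ K (M 0 1) := by
  have hmonic := minpoly.monic (Algebra.IsIntegral.isIntegral (R := ℚ) α)
  have h0 : MvPolynomial.aeval ![α, 1] ((minpoly ℚ α).homogenize (minpoly ℚ α).natDegree) = 0 := by
    rw [aeval_homogenize_pair _ one_ne_zero, div_one, minpoly.aeval, mul_zero]
  have h1 := mem_formAutAbs_aeval hM α 1
  rw [h0, neg_zero, or_self, mul_one, mul_one] at h1
  by_cases hden : algebraMap ℚ K (M 1 0) * α + algebraMap ℚ K (M 1 1) = 0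
  · exfalso
    rw [hden, aeval_homogenize_pair_zero hmonic] at h1
    obtain ⟨h00, h01⟩ := linear_coeffs_eq_zero hdeg (pow_eq_zero_iff (by omega) |>.1 h1)
    obtain ⟨h10, h11⟩ := linear_coeffs_eq_zero hdeg hden
    have h2 := mem_formAutAbs_aeval hM (1 : ℚ) 0
    simp only [h00, h10, h01, h11, map_zero, zero_mul, add_zero,
      aeval_homogenize_pair_zero hmonic] at h2
    rw [zero_pow (by omega), one_pow] at h2
    norm_num at h2
  · rw [aeval_homogenize_pair _ hden, mul_eq_zero, or_iff_right (pow_ne_zero _ hden)] at h1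
    refine ⟨fun hdet => ?_, _, h1, mul_div_cancel₀ _ hden⟩
    have hdet' := congrArg (algebraMap ℚ K) hdet
    rw [map_sub, map_mul, map_mul, map_zero] at hdet'
    by_cases ht : M 1 0 = 0
    · rw [ht, map_zero, zero_mul, zero_add] at hden
      rw [ht, map_zero, mul_zero, sub_zero] at hdet'
      have hs := (mul_eq_zero.1 hdet').resolve_right hden
      refine algebraMap_ne_of_aeval_minpoly hdeg h1 (M 0 1 / M 1 1) ?_
      rw [ht, hs, map_zero, zero_mul, zero_add, zero_add, map_div₀]
    · refine algebraMap_ne_of_aeval_minpoly hdeg h1 (M 0 0 / M 1 0) ?_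
      have ht' : algebraMap ℚ K (M 1 0) ≠ 0 := by simpa using ht
      rw [map_div₀, div_eq_div_iff hden ht']
      linear_combination -hdet'

end Roots

section Commutation

variable {K : Type*} [Field K] [NumberField K] {α : K}

/-- A Möbius transformation that commutes with `x ↦ x ^ 2 - 2` at a number of degree at least `5`
is the identity. -/
theorem moebius_eq_id_of_comm_sq_sub_two (hdeg : 5 ≤ (minpoly ℚ α).natDegree) {s u t v : ℚ}
    (hdet : s * v - u * t ≠ 0) {σ τ : K ≃ₐ[ℚ] K} (hcomm : σ (τ α) = τ (σ α))
    (hτ : τ α = α ^ 2 - 2)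
    (hσ : (algebraMap ℚ K t * α + algebraMap ℚ K v) * σ α =
      algebraMap ℚ K s * α + algebraMap ℚ K u) : t = 0 ∧ u = 0 ∧ s = v := by
  have h1 := congrArg τ hσ
  simp only [map_mul, map_add, AlgEquiv.commutes] at h1
  rw [← hcomm, hτ, map_sub, map_pow, map_ofNat] at h1
  obtain ⟨ha, hb, hc, he, -⟩ := quartic_coeffs_eq_zero (α := α) hdeg
    (a := t * s ^ 2 - 2 * t ^ 3 - s * t ^ 2) (b := t * (2 * s * u - 4 * t * v) - 2 * s * t * v)
    (c := t * (u ^ 2 - 2 * v ^ 2) + (v - 2 * t) * (s ^ 2 - 2 * t ^ 2) - s * v ^ 2 -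
      (u - 2 * s) * t ^ 2)
    (e := (v - 2 * t) * (2 * s * u - 4 * t * v) - (u - 2 * s) * (2 * t * v))
    (f := (v - 2 * t) * (u ^ 2 - 2 * v ^ 2) - (u - 2 * s) * v ^ 2) (by
      simp only [map_sub, map_add, map_mul, map_pow, map_ofNat]
      linear_combination (algebraMap ℚ K t * α + algebraMap ℚ K v) ^ 2 * h1 -
        (algebraMap ℚ K t * (α ^ 2 - 2) + algebraMap ℚ K v) *
        ((algebraMap ℚ K t * α + algebraMap ℚ K v) * σ α + algebraMap ℚ K s * α +
          algebraMap ℚ K u) * hσ)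
  have ht : t = 0 := by
    by_contra ht
    have h2 : (s - 2 * t) * (s + t) = 0 := by
      have : t * ((s - 2 * t) * (s + t)) = 0 := by linear_combination ha
      exact (mul_eq_zero.1 this).resolve_left ht
    have h3 : s * u - 2 * t * v - s * v = 0 := by
      have : t * (s * u - 2 * t * v - s * v) = 0 := by linear_combination hb / 2
      exact (mul_eq_zero.1 this).resolve_left ht
    apply hdet
    rcases mul_eq_zero.1 h2 with h2 | h2
    · have h4 : s = 2 * t := by linear_combination h2
      subst h4
      linear_combination -h3 / 2
    · have h4 : s = -t := by linear_combination h2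
      subst h4
      linear_combination h3
  subst ht
  have hs : s ≠ 0 := by
    rintro rfl
    simp at hdet
  have hv : v ≠ 0 := by
    rintro rfl
    simp at hdet
  refine ⟨rfl, ?_, ?_⟩
  · have : v * s * u = 0 := by linear_combination he / 2
    simpa [hs, hv] using this
  · have : (v * s) * (s - v) = 0 := by linear_combination hc
    exact sub_eq_zero.1 ((mul_eq_zero.1 this).resolve_left (mul_ne_zero hv hs))

theorem moebius_diag_or_antidiag_of_comm_neg (hdeg : 3 ≤ (minpoly ℚ α).natDegree) {s u t v : ℚ}
    (hdet : s * v - u * t ≠ 0) {σ τ : K ≃ₐ[ℚ] K} (hcomm : σ (τ α) = τ (σ α)) (hτ : τ α = -α)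
    (hσ : (algebraMap ℚ K t * α + algebraMap ℚ K v) * σ α =
      algebraMap ℚ K s * α + algebraMap ℚ K u) : (u = 0 ∧ t = 0) ∨ (s = 0 ∧ v = 0) := by
  have h1 := congrArg τ hσ
  simp only [map_mul, map_add, AlgEquiv.commutes] at h1
  rw [← hcomm, hτ, map_neg] at h1
  obtain ⟨ha, -, hb⟩ := quadratic_coeffs_eq_zero (α := α) hdeg
    (a := s * t) (b := 0) (c := -(u * v)) (by
      simp only [map_neg, map_mul, map_zero]
      linear_combination (1 / 2) * (algebraMap ℚ K t * α + algebraMap ℚ K v) * h1 +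
        (1 / 2) * (-algebraMap ℚ K t * α + algebraMap ℚ K v) * hσ)
  rcases mul_eq_zero.1 ha with h | h
  · subst h
    have hu : u ≠ 0 := by
      rintro rfl
      simp at hdet
    right
    simpa [hu] using hb
  · subst h
    have hv : v ≠ 0 := by
      rintro rfl
      simp at hdet
    left
    simpa [hv] using hb

theorem inversion_comm_four_sub {c : ℚ} {σ τ : K ≃ₐ[ℚ] K} (hcomm : σ (τ α) = τ (σ α))
    (hτ : τ α ^ 2 = 4 - α ^ 2) (hσ : α * σ α = algebraMap ℚ K c) :
    α ^ 4 - 4 * α ^ 2 + algebraMap ℚ K c ^ 2 = 0 := by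
  have h1 : τ α ^ 2 * τ (σ α) ^ 2 = algebraMap ℚ K c ^ 2 := by
    rw [← mul_pow, ← map_mul, hσ, AlgEquiv.commutes]
  have h2 := congrArg σ hτ
  rw [map_pow, map_sub, map_pow, map_ofNat, hcomm] at h2
  rw [hτ, h2] at h1
  linear_combination -(1 / 4) * α ^ 2 * h1 -
    (1 / 4) * (4 - α ^ 2) * (α * σ α + algebraMap ℚ K c) * hσ

theorem inversion_comm_four_mul_sub_sq {c : ℚ} (hc : c ≠ 0) {σ τ : K ≃ₐ[ℚ] K}
    (hcomm : σ (τ α) = τ (σ α)) (hτ : τ α ^ 2 = 4 * α ^ 2 - α ^ 4)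
    (hσ : α * σ α = algebraMap ℚ K c) :
    4 * α ^ 4 - (15 + algebraMap ℚ K c ^ 2) * α ^ 2 + 4 * algebraMap ℚ K c ^ 2 = 0 := by
  have h1 : τ α ^ 2 * τ (σ α) ^ 2 = algebraMap ℚ K c ^ 2 := by
    rw [← mul_pow, ← map_mul, hσ, AlgEquiv.commutes]
  have h2 := congrArg σ hτ
  rw [map_pow, map_sub, map_pow, map_mul, map_pow, map_ofNat, hcomm] at h2
  rw [hτ, h2] at h1
  have hc' : algebraMap ℚ K c ≠ 0 := by simpa using hc
  have h3 : (4 - α ^ 2) * (4 - σ α ^ 2) = 1 := by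
    apply mul_left_cancel₀ (pow_ne_zero 2 hc')
    rw [← hσ] at h1 ⊢
    linear_combination h1
  linear_combination -α ^ 2 * h3 - (4 - α ^ 2) * (α * σ α + algebraMap ℚ K c) * hσ

end Commutation

section Cyclotomic

theorem IsPrimitiveRoot.pow_eq_neg_one_of_two_mul {K : Type*} [Field K] {ζ : K} {m : ℕ}
    (hζ : IsPrimitiveRoot ζ (2 * m)) (hm : 0 < m) : ζ ^ m = -1 := by
  have h1 : (ζ ^ m) ^ 2 = 1 := by rw [← pow_mul, mul_comm, hζ.pow_eq_one]
  exact (sq_eq_one_iff.1 h1).resolve_left (hζ.pow_ne_one_of_pos_of_lt hm.ne' (by omega))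

variable {n : ℕ} [NeZero n] {K : Type*} [Field K] [NumberField K]
  [IsCyclotomicExtension {n} ℚ K] {ζ : K}

theorem exists_algEquiv_sq_sub_two (hζ : IsPrimitiveRoot ζ n) (h4 : ¬ 4 ∣ n) :
    ∃ ε : ℚ, ε ^ 2 = 1 ∧ ∃ τ : K ≃ₐ[ℚ] K,
      τ (algebraMap ℚ K ε * (ζ + ζ⁻¹)) = (algebraMap ℚ K ε * (ζ + ζ⁻¹)) ^ 2 - 2 := by
  have hζ0 : ζ ≠ 0 := hζ.ne_zero (NeZero.ne n)
  rcases Nat.even_or_odd n with he | ho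
  · obtain ⟨m, rfl⟩ := he.two_dvd
    have hm : Odd m := by
      rw [← Nat.not_even_iff_odd]
      rintro hm
      obtain ⟨k, rfl⟩ := hm.two_dvd
      exact h4 ⟨k, by ring⟩
    have hpow := hζ.pow_eq_neg_one_of_two_mul hm.pos
    obtain ⟨τ, hτ⟩ := hζ.exists_algEquiv_eq_pow (a := m + 2) (by
      refine Nat.Coprime.mul_right ?_ ?_
      · rw [Nat.coprime_two_right]
        exact hm.add_even even_two
      · rw [Nat.coprime_self_add_left, Nat.coprime_two_left]
        exact hm)
    rw [pow_add, hpow] at hτ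
    refine ⟨-1, by norm_num, τ, ?_⟩
    rw [map_mul, AlgEquiv.commutes, map_add, map_inv₀, hτ]
    simp only [map_neg, map_one]
    field_simp
    ring
  · obtain ⟨τ, hτ⟩ := hζ.exists_algEquiv_eq_pow (a := 2) (by
      rw [Nat.coprime_two_left]
      exact ho)
    refine ⟨1, by norm_num, τ, ?_⟩
    rw [map_mul, AlgEquiv.commutes, map_add, map_inv₀, hτ]
    simp only [map_one]
    field_simp
    ring

theorem exists_algEquiv_neg (hζ : IsPrimitiveRoot ζ n) (h4 : 4 ∣ n) :
    ∃ τ : K ≃ₐ[ℚ] K, τ (ζ + ζ⁻¹) = -(ζ + ζ⁻¹) := by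
  obtain ⟨m, hm⟩ := h4
  have hn := NeZero.ne n
  have hpow : ζ ^ (2 * m) = -1 :=
    IsPrimitiveRoot.pow_eq_neg_one_of_two_mul (by convert hζ using 1; omega) (by omega)
  obtain ⟨τ, hτ⟩ := hζ.exists_algEquiv_eq_pow (a := 2 * m + 1) (by
    rw [hm, show 4 * m = 2 * (2 * m) by ring]
    refine Nat.Coprime.mul_right ?_ ?_
    · rw [Nat.coprime_two_right]
      exact ⟨m, rfl⟩
    · rw [Nat.coprime_self_add_left]
      exact Nat.coprime_one_left _)
  rw [pow_succ, hpow] at hτ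
  refine ⟨τ, ?_⟩
  rw [map_add, map_inv₀, hτ, neg_one_mul, inv_neg]
  ring

theorem exists_algEquiv_four_sub_sq (hζ : IsPrimitiveRoot ζ n) (h8 : 8 ∣ n) :
    ∃ τ : K ≃ₐ[ℚ] K, τ (ζ + ζ⁻¹) ^ 2 = 4 - (ζ + ζ⁻¹) ^ 2 := by
  obtain ⟨m, hm⟩ := h8
  have hn := NeZero.ne n
  have hζ0 : ζ ≠ 0 := hζ.ne_zero (NeZero.ne n)
  have hpow : ζ ^ (4 * m) = -1 :=
    IsPrimitiveRoot.pow_eq_neg_one_of_two_mul (by convert hζ using 1; omega) (by omega)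
  obtain ⟨τ, hτ⟩ := hζ.exists_algEquiv_eq_pow (a := 2 * m + 1) (by
    rw [hm, show 8 * m = 4 * (2 * m) by ring]
    have h2 : (2 * m + 1).Coprime 2 := by
      rw [Nat.coprime_two_right]
      exact ⟨m, rfl⟩
    refine Nat.Coprime.mul_right ?_ ?_
    · exact h2.pow_right 2
    · rw [Nat.coprime_self_add_left]
      exact Nat.coprime_one_left _)
  refine ⟨τ, ?_⟩
  have hi : (ζ ^ (2 * m)) ^ 2 = -1 := by rw [← hpow]; ring
  rw [pow_succ] at hτ
  rw [map_add, map_inv₀, hτ]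
  generalize ζ ^ (2 * m) = i at hi
  have hi0 : i ≠ 0 := by
    rintro rfl
    norm_num at hi
  have hinv : i⁻¹ = -i := by
    rw [inv_eq_iff_eq_inv, eq_comm]
    refine inv_eq_of_mul_eq_one_left ?_
    linear_combination -hi
  rw [mul_inv, hinv]
  field_simp
  linear_combination (ζ ^ 2 - 1) ^ 2 * hi

theorem exists_algEquiv_four_mul_sub (hζ : IsPrimitiveRoot ζ n) (h4 : 4 ∣ n) (h8 : ¬ 8 ∣ n) :
    ∃ τ : K ≃ₐ[ℚ] K, τ (ζ + ζ⁻¹) ^ 2 = 4 * (ζ + ζ⁻¹) ^ 2 - (ζ + ζ⁻¹) ^ 4 := by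
  obtain ⟨m, hm⟩ := h4
  have hn := NeZero.ne n
  have hζ0 : ζ ≠ 0 := hζ.ne_zero (NeZero.ne n)
  have hmo : Odd m := by
    rw [← Nat.not_even_iff_odd]
    intro he
    obtain ⟨k, rfl⟩ := he.two_dvd
    exact h8 ⟨k, by rw [hm]; ring⟩
  have hpow : ζ ^ (2 * m) = -1 :=
    IsPrimitiveRoot.pow_eq_neg_one_of_two_mul (by convert hζ using 1; omega) (by omega)
  obtain ⟨τ, hτ⟩ := hζ.exists_algEquiv_eq_pow (a := m + 2) (by
    have h2 : (m + 2).Coprime 2 := by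
      rw [Nat.coprime_two_right]
      exact hmo.add_even even_two
    rw [hm]
    refine Nat.Coprime.mul_right (h2.pow_right 2) ?_
    rw [Nat.coprime_self_add_left, Nat.coprime_two_left]
    exact hmo)
  refine ⟨τ, ?_⟩
  have hi : (ζ ^ m) ^ 2 = -1 := by rw [← hpow]; ring
  rw [pow_add] at hτ
  rw [map_add, map_inv₀, hτ]
  generalize ζ ^ m = i at hi
  have hi0 : i ≠ 0 := by
    rintro rfl
    norm_num at hi
  have hinv : i⁻¹ = -i := by
    rw [inv_eq_iff_eq_inv, eq_comm]
    refine inv_eq_of_mul_eq_one_left ?_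
    linear_combination -hi
  rw [mul_inv, hinv]
  field_simp
  linear_combination (ζ ^ 4 - 1) ^ 2 * hi

end Cyclotomic

section PolynomialForms

open Polynomial

section Moebius

variable {K : Type*} [Field K] [NumberField K] {α β : K}

theorem cubic_coeffs_eq_zero (hdeg : 4 ≤ (minpoly ℚ α).natDegree) {a b c e : ℚ}
    (h : algebraMap ℚ K a * α ^ 3 + algebraMap ℚ K b * α ^ 2 + algebraMap ℚ K c * α +
      algebraMap ℚ K e = 0) : a = 0 ∧ b = 0 ∧ c = 0 ∧ e = 0 := by
  have hq : (C a * X ^ 3 + C b * X ^ 2 + C c * X + C e : ℚ[X]) = 0 := by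
    refine minpoly_eq_zero_of_aeval (α := α) (by simpa using h) (lt_of_le_of_lt ?_ hdeg)
    compute_degree
  refine ⟨?_, ?_, ?_, ?_⟩
  · simpa [Polynomial.coeff_X, Polynomial.coeff_C] using
      congrArg (fun p => Polynomial.coeff p 3) hq
  · simpa [Polynomial.coeff_X, Polynomial.coeff_C] using
      congrArg (fun p => Polynomial.coeff p 2) hq
  · simpa [Polynomial.coeff_X, Polynomial.coeff_C] using
      congrArg (fun p => Polynomial.coeff p 1) hq
  · simpa [Polynomial.coeff_X, Polynomial.coeff_C] using
      congrArg (fun p => Polynomial.coeff p 0) hq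

theorem moebius_coeffs_proportional (hdeg : 3 ≤ (minpoly ℚ α).natDegree) {s u t v p q r w : ℚ}
    (h₁ : (algebraMap ℚ K t * α + algebraMap ℚ K v) * β = algebraMap ℚ K s * α + algebraMap ℚ K u)
    (h₂ : (algebraMap ℚ K r * α + algebraMap ℚ K w) * β = algebraMap ℚ K p * α + algebraMap ℚ K q) :
    t * p = s * r ∧ t * q + v * p = s * w + u * r ∧ v * q = u * w := by
  obtain ⟨h1, h2, h3⟩ := quadratic_coeffs_eq_zero (α := α) hdeg (a := t * p - s * r)
    (b := t * q + v * p - (s * w + u * r)) (c := v * q - u * w) (by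
      simp only [map_sub, map_add, map_mul]
      linear_combination (algebraMap ℚ K r * α + algebraMap ℚ K w) * h₁ -
        (algebraMap ℚ K t * α + algebraMap ℚ K v) * h₂)
  exact ⟨sub_eq_zero.1 h1, sub_eq_zero.1 h2, sub_eq_zero.1 h3⟩

end Moebius

section Explicit

theorem aeval_homogenize_cubic (a b c x y : ℚ) :
    MvPolynomial.aeval ![x, y] ((X ^ 3 + C a * X ^ 2 + C b * X + C c : ℚ[X]).homogenize 3) =
      x ^ 3 + a * x ^ 2 * y + b * x * y ^ 2 + c * y ^ 3 := by
  simp [Polynomial.homogenize_add, mul_assoc]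

theorem aeval_homogenize_quartic (a b c e x y : ℚ) :
    MvPolynomial.aeval ![x, y]
      ((X ^ 4 + C a * X ^ 3 + C b * X ^ 2 + C c * X + C e : ℚ[X]).homogenize 4) =
      x ^ 4 + a * x ^ 3 * y + b * x ^ 2 * y ^ 2 + c * x * y ^ 3 + e * y ^ 4 := by
  simp [Polynomial.homogenize_add, mul_assoc]

theorem natDegree_cubic_monic (a b c : ℚ) :
    (X ^ 3 + C a * X ^ 2 + C b * X + C c : ℚ[X]).natDegree = 3 := by
  compute_degree!

theorem natDegree_quartic_monic (a b c e : ℚ) :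
    (X ^ 4 + C a * X ^ 3 + C b * X ^ 2 + C c * X + C e : ℚ[X]).natDegree = 4 := by
  compute_degree!

/-- The projective automorphisms of order `3` of the simplest cubic forms. -/
def cubicAutMatrices (ε : ℚ) : Set (Matrix (Fin 2) (Fin 2) ℚ) :=
  {1, !![-1, -ε; ε, 0], !![0, ε; -ε, -1]}

theorem formSubst_cubic {ε : ℚ} (hε : ε = 1 ∨ ε = -1) (a : ℚ)
    {M : Matrix (Fin 2) (Fin 2) ℚ} (hM : M ∈ cubicAutMatrices ε) :
    formSubst ((X ^ 3 + C (ε * a) * X ^ 2 + C (a - 3) * X + C (-ε) : ℚ[X]).homogenize 3) M =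
      (X ^ 3 + C (ε * a) * X ^ 2 + C (a - 3) * X + C (-ε) : ℚ[X]).homogenize 3 := by
  refine formSubst_eq_iff.2 fun x y => ?_
  rw [aeval_homogenize_cubic, aeval_homogenize_cubic]
  rcases hM with rfl | rfl | rfl
  · simp
  · rcases hε with rfl | rfl <;> simp <;> ring
  · rcases hε with rfl | rfl <;> simp <;> ring

theorem eq_or_eq_neg_of_entries {s l : ℚ} {M N : Matrix (Fin 2) (Fin 2) ℚ} {d : ℕ} (hd : d ≠ 0)
    (hM : M = l • N) (hs : s = l ^ d) (h : s = 1 ∨ s = -1) : M = N ∨ -M = N := by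
  subst hs
  rcases eq_one_or_eq_neg_one_of_pow hd h with rfl | rfl
  · left
    rw [hM, one_smul]
  · right
    rw [hM, neg_smul, one_smul, neg_neg]

variable {K : Type*} [Field K] [NumberField K] {α : K}

theorem mem_cubicAutMatrices {ε : ℚ} (hε : ε = 1 ∨ ε = -1) {a : ℚ}
    (hα : minpoly ℚ α = X ^ 3 + C (ε * a) * X ^ 2 + C (a - 3) * X + C (-ε))
    {M : Matrix (Fin 2) (Fin 2) ℚ}
    (hM : M ∈ formAutAbs
      ((X ^ 3 + C (ε * a) * X ^ 2 + C (a - 3) * X + C (-ε) : ℚ[X]).homogenize 3)) :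
    M ∈ cubicAutMatrices ε ∨ -M ∈ cubicAutMatrices ε := by
  have hnat : (minpoly ℚ α).natDegree = 3 := by rw [hα, natDegree_cubic_monic]
  have hM' : M ∈ formAutAbs ((minpoly ℚ α).homogenize (minpoly ℚ α).natDegree) := by
    rwa [hnat, hα]
  obtain ⟨-, β, hβ, hrel⟩ := exists_root_of_mem_formAutAbs hnat.ge hM'
  have hα0 := minpoly.aeval ℚ α
  have hval := mem_formAutAbs_aeval (A := ℚ) hM 1 0
  simp only [Algebra.algebraMap_self, RingHom.id_apply, aeval_homogenize_cubic] at hval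
  rw [hα] at hα0 hβ
  simp only [map_add, map_mul, map_pow, aeval_X, aeval_C, map_sub, map_neg, map_ofNat] at hα0 hβ
  have hfac : (β - α) * (algebraMap ℚ K ε * α * β + α + algebraMap ℚ K ε) *
      ((algebraMap ℚ K ε * α + 1) * β + algebraMap ℚ K ε) = 0 := by
    rcases hε with rfl | rfl
    · simp only [map_one] at hα0 hβ ⊢
      linear_combination (α ^ 2 + α) * hβ - (β ^ 2 + β) * hα0
    · simp only [map_one, map_neg] at hα0 hβ ⊢
      linear_combination (α ^ 2 - α) * hβ - (β ^ 2 - β) * hα0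
  rcases mul_eq_zero.1 hfac with hfac | h
  · rcases mul_eq_zero.1 hfac with h | h
    · obtain ⟨h1, h2, h3⟩ := moebius_coeffs_proportional (p := 1) (q := 0) (r := 0) (w := 1)
        hnat.ge hrel (by simp only [map_one, map_zero]; linear_combination h)
      have hMN : M = M 0 0 • 1 := by
        ext i j
        fin_cases i <;> fin_cases j <;> simp <;> linarith
      have key := eq_or_eq_neg_of_entries (d := 3) (by norm_num) hMN rfl (by
        have h10 : M 1 0 = 0 := by linarith
        rw [h10] at hval
        simpa using hval)
      simp only [cubicAutMatrices, Set.mem_insert_iff, Set.mem_singleton_iff]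
      tauto
    · obtain ⟨h1, h2, h3⟩ := moebius_coeffs_proportional (p := -1) (q := -ε) (r := ε) (w := 0)
        hnat.ge hrel (by simp only [map_one, map_zero, map_neg]; linear_combination h)
      have hMN : M = (-M 0 0) • !![-1, -ε; ε, 0] := by
        ext i j
        rcases hε with rfl | rfl <;> fin_cases i <;> fin_cases j <;> simp <;> linarith
      have key := eq_or_eq_neg_of_entries (d := 3) (by norm_num) hMN rfl (by
        have h10 : M 1 0 = (-M 0 0) * ε := by rcases hε with rfl | rfl <;> linarith
        rw [h10] at hval
        rcases hε with rfl | rfl <;> ring_nf at hval ⊢ <;> tauto)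
      simp only [cubicAutMatrices, Set.mem_insert_iff, Set.mem_singleton_iff]
      tauto
  · obtain ⟨h1, h2, h3⟩ := moebius_coeffs_proportional (p := 0) (q := ε) (r := -ε) (w := -1)
      hnat.ge hrel (by simp only [map_one, map_zero, map_neg]; linear_combination -h)
    have hMN : M = (ε * M 0 1) • !![0, ε; -ε, -1] := by
      ext i j
      rcases hε with rfl | rfl <;> fin_cases i <;> fin_cases j <;> simp <;> linarith
    have key := eq_or_eq_neg_of_entries (s := -(M 1 0 ^ 3 * ε)) (d := 3) (by norm_num) hMN (by
        have h10 : M 1 0 = -M 0 1 := by rcases hε with rfl | rfl <;> linarith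
        rw [h10]
        rcases hε with rfl | rfl <;> ring) (by
      have h00 : M 0 0 = 0 := by rcases hε with rfl | rfl <;> linarith
      rw [h00] at hval
      rcases hε with rfl | rfl <;> ring_nf at hval ⊢ <;> tauto)
    simp only [cubicAutMatrices, Set.mem_insert_iff, Set.mem_singleton_iff]
    tauto

/-- The automorphisms of the quartic forms attached to the conductors `15` and `30`. -/
def quarticAutMatrices (ε : ℚ) : Set (Matrix (Fin 2) (Fin 2) ℚ) :=
  {1, -1, !![-1, 2 * ε; -ε, 1], -!![-1, 2 * ε; -ε, 1]}

theorem formSubst_quartic {ε : ℚ} (hε : ε = 1 ∨ ε = -1)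
    {M : Matrix (Fin 2) (Fin 2) ℚ} (hM : M ∈ quarticAutMatrices ε) :
    formSubst ((X ^ 4 + C (-ε) * X ^ 3 + C (-4) * X ^ 2 + C (4 * ε) * X + C 1 : ℚ[X]).homogenize 4)
        M =
      (X ^ 4 + C (-ε) * X ^ 3 + C (-4) * X ^ 2 + C (4 * ε) * X + C 1 : ℚ[X]).homogenize 4 := by
  refine formSubst_eq_iff.2 fun x y => ?_
  rw [aeval_homogenize_quartic, aeval_homogenize_quartic]
  rcases hM with rfl | rfl | rfl | rfl
  · simp
  · simp
    ring
  · rcases hε with rfl | rfl <;> simp <;> ring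
  · rcases hε with rfl | rfl <;> simp <;> ring

theorem mem_quarticAutMatrices {ε : ℚ} (hε : ε = 1 ∨ ε = -1)
    (hα : minpoly ℚ α = X ^ 4 + C (-ε) * X ^ 3 + C (-4) * X ^ 2 + C (4 * ε) * X + C 1)
    {M : Matrix (Fin 2) (Fin 2) ℚ}
    (hM : M ∈ formAutAbs
      ((X ^ 4 + C (-ε) * X ^ 3 + C (-4) * X ^ 2 + C (4 * ε) * X + C 1 : ℚ[X]).homogenize 4)) :
    M ∈ quarticAutMatrices ε := by
  have hnat : (minpoly ℚ α).natDegree = 4 := by rw [hα, natDegree_quartic_monic]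
  have hdeg : 3 ≤ (minpoly ℚ α).natDegree := by omega
  have hM' : M ∈ formAutAbs ((minpoly ℚ α).homogenize (minpoly ℚ α).natDegree) := by
    rwa [hnat, hα]
  obtain ⟨hdet, β, hβ, hrel⟩ := exists_root_of_mem_formAutAbs hdeg hM'
  have hα0 := minpoly.aeval ℚ α
  have hval := mem_formAutAbs_aeval (A := ℚ) hM 1 0
  simp only [Algebra.algebraMap_self, RingHom.id_apply, aeval_homogenize_quartic] at hval
  rw [hα] at hα0 hβ
  simp only [map_add, map_mul, map_pow, aeval_X, aeval_C, map_neg, map_ofNat,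
    map_one] at hα0 hβ
  have hfac : (β - α) * ((β - algebraMap ℚ K ε * (α ^ 2 - 2)) *
      ((β - (α ^ 3 - 4 * α + algebraMap ℚ K ε)) *
      (β - (-α ^ 3 - algebraMap ℚ K ε * α ^ 2 + 3 * α + 2 * algebraMap ℚ K ε)))) = 0 := by
    rcases hε with rfl | rfl
    · simp only [map_one] at hα0 hβ ⊢
      linear_combination hβ + (-α ^ 5 + α ^ 4 * β - 2 * α ^ 4 + 3 * α ^ 3 * β + 3 * α ^ 3 -
        α ^ 2 * β ^ 2 - α ^ 2 * β + 6 * α ^ 2 - 2 * α * β ^ 2 - 6 * α * β - 1) * hα0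
    · simp only [map_one, map_neg] at hα0 hβ ⊢
      linear_combination hβ + (α ^ 5 - α ^ 4 * β - 2 * α ^ 4 + 3 * α ^ 3 * β - 3 * α ^ 3 -
        α ^ 2 * β ^ 2 + α ^ 2 * β + 6 * α ^ 2 + 2 * α * β ^ 2 - 6 * α * β - 1) * hα0
  rcases mul_eq_zero.1 hfac with h | hfac
  · obtain ⟨h1, h2, h3⟩ := moebius_coeffs_proportional (p := 1) (q := 0) (r := 0) (w := 1)
      hdeg hrel (by simp only [map_one, map_zero]; linear_combination h)
    have hMN : M = M 0 0 • 1 := by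
      ext i j
      fin_cases i <;> fin_cases j <;> simp <;> linarith
    have key := eq_or_eq_neg_of_entries (d := 4) (by norm_num) hMN rfl (by
      have h10 : M 1 0 = 0 := by linarith
      rw [h10] at hval
      simpa using hval)
    rw [neg_eq_iff_eq_neg] at key
    simp only [quarticAutMatrices, Set.mem_insert_iff, Set.mem_singleton_iff]
    tauto
  rcases mul_eq_zero.1 hfac with h | hfac
  · exfalso
    apply hdet
    rw [sub_eq_zero.1 h] at hrel
    obtain ⟨h1, h2, -, -⟩ := cubic_coeffs_eq_zero (α := α) hnat.ge (a := M 1 0 * ε)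
      (b := M 1 1 * ε) (c := -2 * M 1 0 * ε - M 0 0) (e := -2 * M 1 1 * ε - M 0 1) (by
        simp only [map_sub, map_mul, map_neg, map_ofNat]
        linear_combination hrel)
    have ht : M 1 0 = 0 := by rcases hε with rfl | rfl <;> linarith
    have hv : M 1 1 = 0 := by rcases hε with rfl | rfl <;> linarith
    rw [ht, hv]
    ring
  rcases mul_eq_zero.1 hfac with h | h
  · obtain ⟨h1, h2, h3⟩ := moebius_coeffs_proportional (p := -1) (q := 2 * ε) (r := -ε) (w := 1)
      hdeg hrel (by
        rw [sub_eq_zero.1 h]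
        rcases hε with rfl | rfl
        · simp only [map_one, map_neg, map_mul, map_ofNat] at hα0 ⊢
          linear_combination -hα0
        · simp only [map_one, map_neg, map_mul, map_ofNat] at hα0 ⊢
          linear_combination hα0)
    have hMN : M = (-M 0 0) • !![-1, 2 * ε; -ε, 1] := by
      ext i j
      rcases hε with rfl | rfl <;> fin_cases i <;> fin_cases j <;> simp <;> linarith
    have key := eq_or_eq_neg_of_entries (d := 4) (by norm_num) hMN rfl (by
      have h10 : M 1 0 = M 0 0 * ε := by rcases hε with rfl | rfl <;> linarith
      rw [h10] at hval
      rcases hε with rfl | rfl <;> ring_nf at hval ⊢ <;> tauto)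
    rw [neg_eq_iff_eq_neg] at key
    simp only [quarticAutMatrices, Set.mem_insert_iff, Set.mem_singleton_iff]
    tauto
  · exfalso
    apply hdet
    rw [sub_eq_zero.1 h] at hrel
    obtain ⟨h1, h2, -, -⟩ := cubic_coeffs_eq_zero (α := α) hnat.ge
      (a := -2 * ε * M 1 0 - M 1 1) (b := -M 1 0 - ε * M 1 1)
      (c := 6 * ε * M 1 0 + 3 * M 1 1 - M 0 0) (e := M 1 0 + 2 * ε * M 1 1 - M 0 1) (by
        rcases hε with rfl | rfl
        · simp only [map_add, map_sub, map_mul, map_neg, map_ofNat, map_one] at hα0 hrel ⊢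
          linear_combination hrel + algebraMap ℚ K (M 1 0) * hα0
        · simp only [map_add, map_sub, map_mul, map_neg, map_ofNat, map_one] at hα0 hrel ⊢
          linear_combination hrel + algebraMap ℚ K (M 1 0) * hα0)
    have ht : M 1 0 = 0 := by rcases hε with rfl | rfl <;> linarith
    have hv : M 1 1 = 0 := by rcases hε with rfl | rfl <;> linarith
    rw [ht, hv]
    ring

end Explicit

/-- A finite set of rational matrices that consists of products of two powers of elements of a
finite set `S` and is stable under right multiplication by `S` is the group generated by `S`. -/
theorem matrixGroup_eq_coe (S T : Finset (Matrix (Fin 2) (Fin 2) ℚ)) (h1 : 1 ∈ T)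
    (hinv : ∀ s ∈ S, s * s ^ 11 = 1) (hmul : ∀ x ∈ T, ∀ s ∈ S, x * s ∈ T)
    (hgen : ∀ x ∈ T, ∃ a ∈ S, ∃ i ∈ Finset.range 6, ∃ b ∈ S, ∃ j ∈ Finset.range 3,
      a ^ i * b ^ j = x) :
    matrixGroup (S : Set (Matrix (Fin 2) (Fin 2) ℚ)) = T := by
  have hunit : ∀ s ∈ S, ∃ g : GL (Fin 2) ℚ, (g : Matrix (Fin 2) (Fin 2) ℚ) = s ∧
      g ∈ Subgroup.closure {g : GL (Fin 2) ℚ | (g : Matrix (Fin 2) (Fin 2) ℚ) ∈ (S : Set _)} :=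
    fun s hs => ⟨⟨s, s ^ 11, hinv s hs, by rw [← pow_succ, pow_succ', hinv s hs]⟩, rfl,
      Subgroup.subset_closure hs⟩
  apply Set.Subset.antisymm
  · rintro _ ⟨g, hg, rfl⟩
    change (g : Matrix (Fin 2) (Fin 2) ℚ) ∈ T
    induction hg using Subgroup.closure_induction_right with
    | one => exact h1
    | mul_right x _ y hy ih => exact hmul _ ih _ hy
    | mul_inv_cancel x _ y hy ih =>
      have hpow : ∀ k : ℕ, ((x * y ^ k : GL (Fin 2) ℚ) : Matrix (Fin 2) (Fin 2) ℚ) ∈ T := by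
        intro k
        induction k with
        | zero => simpa using ih
        | succ k ihk =>
          rw [pow_succ, ← mul_assoc]
          exact hmul _ ihk _ hy
      have hy' : y⁻¹ = y ^ 11 := by
        refine inv_eq_of_mul_eq_one_right (Units.ext ?_)
        exact hinv _ hy
      rw [hy']
      exact hpow 11
  · intro x hx
    obtain ⟨a, ha, i, -, b, hb, j, -, rfl⟩ := hgen x hx
    obtain ⟨g, rfl, hg⟩ := hunit a ha
    obtain ⟨k, rfl, hk⟩ := hunit b hb
    exact ⟨g ^ i * k ^ j, mul_mem (pow_mem hg i) (pow_mem hk j), rfl⟩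

theorem matrixGroup_singleton (a : Matrix (Fin 2) (Fin 2) ℚ)
    (T : Finset (Matrix (Fin 2) (Fin 2) ℚ)) (h1 : 1 ∈ T)
    (hinv : ∀ s ∈ ({a} : Finset _), s * s ^ 11 = 1)
    (hmul : ∀ x ∈ T, ∀ s ∈ ({a} : Finset _), x * s ∈ T)
    (hgen : ∀ x ∈ T, ∃ a' ∈ ({a} : Finset _), ∃ i ∈ Finset.range 6, ∃ b ∈ ({a} : Finset _),
      ∃ j ∈ Finset.range 3, a' ^ i * b ^ j = x) :
    matrixGroup {a} = T := by
  rw [← matrixGroup_eq_coe {a} T h1 hinv hmul hgen, Finset.coe_singleton]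

theorem matrixGroup_pair (a b : Matrix (Fin 2) (Fin 2) ℚ)
    (T : Finset (Matrix (Fin 2) (Fin 2) ℚ)) (h1 : 1 ∈ T)
    (hinv : ∀ s ∈ ({a, b} : Finset _), s * s ^ 11 = 1)
    (hmul : ∀ x ∈ T, ∀ s ∈ ({a, b} : Finset _), x * s ∈ T)
    (hgen : ∀ x ∈ T, ∃ a' ∈ ({a, b} : Finset _), ∃ i ∈ Finset.range 6, ∃ b' ∈ ({a, b} : Finset _),
      ∃ j ∈ Finset.range 3, a' ^ i * b' ^ j = x) :
    matrixGroup {a, b} = T := by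
  rw [← matrixGroup_eq_coe {a, b} T h1 hinv hmul hgen, Finset.coe_pair]


theorem GLConjugate.of_image {P Q : Matrix (Fin 2) (Fin 2) ℚ}
    (T U : Finset (Matrix (Fin 2) (Fin 2) ℚ)) (hPQ : P * Q = 1) (hQP : Q * P = 1)
    (h : U.image (fun M => P * M * Q) = T) : GLConjugate (T : Set _) (U : Set _) := by
  refine ⟨⟨P, Q, hPQ, hQP⟩, ?_⟩
  rw [← h, Finset.coe_image]
  rfl

theorem groupC1_eq : groupC1 = (({1} : Finset (Matrix (Fin 2) (Fin 2) ℚ)) : Set _) :=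
  matrixGroup_singleton _ _ (by decide +kernel) (by decide +kernel) (by decide +kernel)
    (by decide +kernel)

theorem groupC2_eq : groupC2 =
    (({1, -1} :
      Finset (Matrix (Fin 2) (Fin 2) ℚ)) : Set _) :=
  matrixGroup_singleton _ _ (by decide +kernel) (by decide +kernel) (by decide +kernel)
    (by decide +kernel)

theorem groupC3_eq : groupC3 =
    (({1, !![0, 1; -1, -1], !![-1, -1; 1, 0]} :
      Finset (Matrix (Fin 2) (Fin 2) ℚ)) : Set _) :=
  matrixGroup_singleton _ _ (by decide +kernel) (by decide +kernel) (by decide +kernel)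
    (by decide +kernel)

theorem groupC4_eq : groupC4 =
    (({1, !![0, 1; -1, 0], -1, !![0, -1; 1, 0]} :
      Finset (Matrix (Fin 2) (Fin 2) ℚ)) : Set _) :=
  matrixGroup_singleton _ _ (by decide +kernel) (by decide +kernel) (by decide +kernel)
    (by decide +kernel)

theorem groupC6_eq : groupC6 =
    (({1, !![0, -1; 1, 1], !![-1, -1; 1, 0], -1, !![0, 1; -1, -1], !![1, 1; -1, 0]} :
      Finset (Matrix (Fin 2) (Fin 2) ℚ)) : Set _) :=
  matrixGroup_singleton _ _ (by decide +kernel) (by decide +kernel) (by decide +kernel)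
    (by decide +kernel)

theorem groupD2_eq : groupD2 =
    (({1, !![0, 1; 1, 0], -1, !![0, -1; -1, 0]} :
      Finset (Matrix (Fin 2) (Fin 2) ℚ)) : Set _) :=
  matrixGroup_pair _ _ _ (by decide +kernel) (by decide +kernel) (by decide +kernel)
    (by decide +kernel)

theorem groupD4_eq : groupD4 =
    (({1, !![0, 1; 1, 0], !![0, 1; -1, 0], !![-1, 0; 0, 1], !![1, 0; 0, -1], -1,
      !![0, -1; 1, 0], !![0, -1; -1, 0]} :
      Finset (Matrix (Fin 2) (Fin 2) ℚ)) : Set _) :=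
  matrixGroup_pair _ _ _ (by decide +kernel) (by decide +kernel) (by decide +kernel)
    (by decide +kernel)

theorem matrixGroup_diagonal_eq : matrixGroup {!![-1, 0; 0, 1], !![1, 0; 0, -1]} =
    (({1, !![-1, 0; 0, 1], !![1, 0; 0, -1], -1} :
      Finset (Matrix (Fin 2) (Fin 2) ℚ)) : Set _) :=
  matrixGroup_pair _ _ _ (by decide +kernel) (by decide +kernel) (by decide +kernel)
    (by decide +kernel)

theorem GLConjugate_diagonal :
    GLConjugate (matrixGroup {!![-1, 0; 0, 1], !![1, 0; 0, -1]}) groupD2 := by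
  rw [matrixGroup_diagonal_eq, groupD2_eq]
  exact .of_image (P := !![-2, -2; -2, 2]) (Q := !![-1/4, -1/4; -1/4, 1/4]) _ _ (by decide +kernel)
    (by decide +kernel) (by decide +kernel)

theorem matrixGroup_order_three_eq : matrixGroup {!![-1, -1; 1, 0]} =
    (({1, !![-1, -1; 1, 0], !![0, 1; -1, -1]} :
      Finset (Matrix (Fin 2) (Fin 2) ℚ)) : Set _) :=
  matrixGroup_singleton _ _ (by decide +kernel) (by decide +kernel) (by decide +kernel)
    (by decide +kernel)

theorem GLConjugate_order_three :
    GLConjugate (matrixGroup {!![-1, -1; 1, 0]}) groupC3 := by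
  rw [matrixGroup_order_three_eq, groupC3_eq]
  exact .of_image (P := !![1, 1; 0, -1]) (Q := !![1, 1; 0, -1]) _ _ (by decide +kernel)
    (by decide +kernel) (by decide +kernel)

theorem matrixGroup_order_six_eq : matrixGroup {!![-1, -1; 1, 0], !![-1, 0; 0, -1]} =
    (({1, !![-1, -1; 1, 0], -1, !![0, 1; -1, -1], !![1, 1; -1, 0], !![0, -1; 1, 1]} :
      Finset (Matrix (Fin 2) (Fin 2) ℚ)) : Set _) :=
  matrixGroup_pair _ _ _ (by decide +kernel) (by decide +kernel) (by decide +kernel)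
    (by decide +kernel)

theorem GLConjugate_order_six :
    GLConjugate (matrixGroup {!![-1, -1; 1, 0], !![-1, 0; 0, -1]}) groupC6 := by
  rw [matrixGroup_order_six_eq, groupC6_eq]
  exact .of_image (P := !![1, 1; 0, -1]) (Q := !![1, 1; 0, -1]) _ _ (by decide +kernel)
    (by decide +kernel) (by decide +kernel)

theorem matrixGroup_order_three_twist_eq : matrixGroup {!![-1, 1; -1, 0]} =
    (({1, !![-1, 1; -1, 0], !![0, -1; 1, -1]} :
      Finset (Matrix (Fin 2) (Fin 2) ℚ)) : Set _) :=
  matrixGroup_singleton _ _ (by decide +kernel) (by decide +kernel) (by decide +kernel)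
    (by decide +kernel)

theorem GLConjugate_order_three_twist :
    GLConjugate (matrixGroup {!![-1, 1; -1, 0]}) groupC3 := by
  rw [matrixGroup_order_three_twist_eq, groupC3_eq]
  exact .of_image (P := !![1, 1; 1, 0]) (Q := !![0, 1; 1, -1]) _ _ (by decide +kernel)
    (by decide +kernel) (by decide +kernel)

theorem matrixGroup_order_six_twist_eq : matrixGroup {!![-1, 1; -1, 0], !![-1, 0; 0, -1]} =
    (({1, !![-1, 1; -1, 0], -1, !![0, -1; 1, -1], !![1, -1; 1, 0], !![0, 1; -1, 1]} :
      Finset (Matrix (Fin 2) (Fin 2) ℚ)) : Set _) :=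
  matrixGroup_pair _ _ _ (by decide +kernel) (by decide +kernel) (by decide +kernel)
    (by decide +kernel)

theorem GLConjugate_order_six_twist :
    GLConjugate (matrixGroup {!![-1, 1; -1, 0], !![-1, 0; 0, -1]}) groupC6 := by
  rw [matrixGroup_order_six_twist_eq, groupC6_eq]
  exact .of_image (P := !![1, 1; 1, 0]) (Q := !![0, 1; 1, -1]) _ _ (by decide +kernel)
    (by decide +kernel) (by decide +kernel)

theorem matrixGroup_order_four_eq : matrixGroup {!![-1, 2; -1, 1]} =
    (({1, !![-1, 2; -1, 1], -1, !![1, -2; 1, -1]} :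
      Finset (Matrix (Fin 2) (Fin 2) ℚ)) : Set _) :=
  matrixGroup_singleton _ _ (by decide +kernel) (by decide +kernel) (by decide +kernel)
    (by decide +kernel)

theorem GLConjugate_order_four :
    GLConjugate (matrixGroup {!![-1, 2; -1, 1]}) groupC4 := by
  rw [matrixGroup_order_four_eq, groupC4_eq]
  exact .of_image (P := !![1, 1; 1, 0]) (Q := !![0, 1; 1, -1]) _ _ (by decide +kernel)
    (by decide +kernel) (by decide +kernel)

theorem matrixGroup_order_four_twist_eq : matrixGroup {!![1, 2; -1, -1]} =
    (({1, !![1, 2; -1, -1], -1, !![-1, -2; 1, 1]} :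
      Finset (Matrix (Fin 2) (Fin 2) ℚ)) : Set _) :=
  matrixGroup_singleton _ _ (by decide +kernel) (by decide +kernel) (by decide +kernel)
    (by decide +kernel)

theorem GLConjugate_order_four_twist :
    GLConjugate (matrixGroup {!![1, 2; -1, -1]}) groupC4 := by
  rw [matrixGroup_order_four_twist_eq, groupC4_eq]
  exact .of_image (P := !![1, 1; 0, -1]) (Q := !![1, 1; 0, -1]) _ _ (by decide +kernel)
    (by decide +kernel) (by decide +kernel)

theorem GLConjugate.refl (H : Set (Matrix (Fin 2) (Fin 2) ℚ)) : GLConjugate H H :=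
  ⟨1, by simp⟩

section RootsOfUnity

variable {K : Type*} [Field K] {η : K}

theorem add_inv_root_of_pow_seven (h : η ^ 7 = 1) (h1 : η ≠ 1) :
    (η + η⁻¹) ^ 3 + (η + η⁻¹) ^ 2 - 2 * (η + η⁻¹) - 1 = 0 := by
  have h0 : η ≠ 0 := by
    rintro rfl
    norm_num at h
  have h2 : η ^ 6 + η ^ 5 + η ^ 4 + η ^ 3 + η ^ 2 + η + 1 = 0 :=
    mul_left_cancel₀ (sub_ne_zero.2 h1) (by linear_combination h)
  field_simp
  linear_combination h2

theorem add_inv_root_of_pow_nine (h : η ^ 9 = 1) (h1 : η ^ 3 ≠ 1) :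
    (η + η⁻¹) ^ 3 - 3 * (η + η⁻¹) + 1 = 0 := by
  have h0 : η ≠ 0 := by
    rintro rfl
    norm_num at h
  have h2 : η ^ 6 + η ^ 3 + 1 = 0 :=
    mul_left_cancel₀ (sub_ne_zero.2 h1) (by linear_combination h)
  field_simp
  linear_combination h2

theorem add_inv_root_of_pow_fifteen (h : η ^ 15 = 1) (h1 : η ^ 3 ≠ 1) (h5 : η ^ 5 ≠ 1) :
    (η + η⁻¹) ^ 4 - (η + η⁻¹) ^ 3 - 4 * (η + η⁻¹) ^ 2 + 4 * (η + η⁻¹) + 1 = 0 := by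
  have h0 : η ≠ 0 := by
    rintro rfl
    norm_num at h
  have h2 : η ^ 10 + η ^ 5 + 1 = 0 :=
    mul_left_cancel₀ (sub_ne_zero.2 h5) (by linear_combination h)
  have h3 : η ^ 2 + η + 1 ≠ 0 := fun h3 => h1 (by linear_combination (η - 1) * h3)
  have h4 : η ^ 8 - η ^ 7 + η ^ 5 - η ^ 4 + η ^ 3 - η + 1 = 0 :=
    mul_left_cancel₀ h3 (by linear_combination h2)
  field_simp
  linear_combination h4

theorem add_inv_root_of_pow_eight (h : η ^ 8 = -1) (h0 : η ≠ 0) :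
    (η + η⁻¹) ^ 4 - 4 * (η + η⁻¹) ^ 2 + 2 = 0 := by
  field_simp
  linear_combination h

theorem add_inv_root_of_pow_ten (h : η ^ 10 = -1) (h0 : η ≠ 0) (h2 : η ^ 2 ≠ -1) :
    (η + η⁻¹) ^ 4 - 5 * (η + η⁻¹) ^ 2 + 5 = 0 := by
  have h3 : η ^ 8 - η ^ 6 + η ^ 4 - η ^ 2 + 1 = 0 :=
    mul_left_cancel₀ (sub_ne_zero.2 h2) (by linear_combination h)
  field_simp
  linear_combination h3

theorem add_inv_root_of_pow_twelve (h : η ^ 12 = -1) (h0 : η ≠ 0) (h2 : η ^ 4 ≠ -1) :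
    (η + η⁻¹) ^ 4 - 4 * (η + η⁻¹) ^ 2 + 1 = 0 := by
  have h3 : η ^ 8 - η ^ 4 + 1 = 0 :=
    mul_left_cancel₀ (sub_ne_zero.2 h2) (by linear_combination h)
  field_simp
  linear_combination h3

end RootsOfUnity

theorem natDegree_minpoly_neg {K : Type*} [Field K] [Algebra ℚ K] (α : K) :
    (minpoly ℚ (-α)).natDegree = (minpoly ℚ α).natDegree := by
  rw [minpoly.neg]
  have h : ((-1 : ℚ[X]) ^ (minpoly ℚ α).natDegree) = C ((-1) ^ (minpoly ℚ α).natDegree) := by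
    simp
  rw [h, natDegree_C_mul (pow_ne_zero _ (by norm_num)), natDegree_comp, natDegree_neg, natDegree_X,
    mul_one]

section Cyclotomic

variable {n : ℕ} [NeZero n] {K : Type*} [Field K] [NumberField K]
  [IsCyclotomicExtension {n} ℚ K] {ζ : K}

theorem psiForm_eq_homogenize (hζ : IsPrimitiveRoot ζ n) :
    psiForm n = (minpoly ℚ (ζ + ζ⁻¹)).homogenize (minpoly ℚ (ζ + ζ⁻¹)).natDegree := by
  rw [psiForm, psiPoly_eq_minpoly hζ]

theorem minpoly_add_inv_eq (hζ : IsPrimitiveRoot ζ n) (hn : 2 < n) {q : ℚ[X]} (hq : q.Monic)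
    (hdeg : q.natDegree = n.totient / 2) (h : aeval (ζ + ζ⁻¹) q = 0) :
    minpoly ℚ (ζ + ζ⁻¹) = q :=
  (eq_of_monic_of_dvd_of_natDegree_le (minpoly.monic (Algebra.IsIntegral.isIntegral _)) hq
    (minpoly.dvd ℚ _ h) (by rw [hdeg, hζ.natDegree_minpoly_add_inv hn])).symm

theorem exists_algEquiv_of_mem_formAutAbs (hζ : IsPrimitiveRoot ζ n)
    (hdeg : 3 ≤ (minpoly ℚ (ζ + ζ⁻¹)).natDegree) {M : Matrix (Fin 2) (Fin 2) ℚ}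
    (hM : M ∈ formAutAbs (psiForm n)) :
    M 0 0 * M 1 1 - M 0 1 * M 1 0 ≠ 0 ∧ ∃ σ : K ≃ₐ[ℚ] K,
      (algebraMap ℚ K (M 1 0) * (ζ + ζ⁻¹) + algebraMap ℚ K (M 1 1)) * σ (ζ + ζ⁻¹) =
        algebraMap ℚ K (M 0 0) * (ζ + ζ⁻¹) + algebraMap ℚ K (M 0 1) := by
  rw [psiForm_eq_homogenize hζ] at hM
  obtain ⟨hdet, β, hβ, hrel⟩ := exists_root_of_mem_formAutAbs hdeg hM
  have := IsCyclotomicExtension.isGalois {n} ℚ K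
  obtain ⟨σ, rfl⟩ := minpoly.exists_algEquiv_of_root'
    (Algebra.IsAlgebraic.isAlgebraic (R := ℚ) (ζ + ζ⁻¹)) hβ
  exact ⟨hdet, σ, hrel⟩

theorem scalar_of_mem_formAutAbs (hζ : IsPrimitiveRoot ζ n) (h4 : ¬ 4 ∣ n)
    (hdeg : 5 ≤ (minpoly ℚ (ζ + ζ⁻¹)).natDegree) {M : Matrix (Fin 2) (Fin 2) ℚ}
    (hM : M ∈ formAutAbs (psiForm n)) : M 1 0 = 0 ∧ M 0 1 = 0 ∧ M 0 0 = M 1 1 := by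
  obtain ⟨hdet, σ, hσ⟩ := exists_algEquiv_of_mem_formAutAbs hζ (by omega) hM
  obtain ⟨ε, hε, τ, hτ⟩ := exists_algEquiv_sq_sub_two hζ h4
  have hε0 : ε ≠ 0 := by
    rintro rfl
    norm_num at hε
  have hεK : algebraMap ℚ K ε ^ 2 = 1 := by rw [← map_pow, hε, map_one]
  have hdeg' : 5 ≤ (minpoly ℚ (algebraMap ℚ K ε * (ζ + ζ⁻¹))).natDegree := by
    rcases sq_eq_one_iff.1 hε with rfl | rfl
    · simpa only [map_one, one_mul] using hdeg
    · simpa only [map_neg, map_one, neg_one_mul, natDegree_minpoly_neg] using hdeg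
  obtain ⟨ht, hu, hs⟩ := moebius_eq_id_of_comm_sq_sub_two hdeg' (s := M 0 0) (u := ε * M 0 1)
    (t := ε * M 1 0) (v := M 1 1) (by
      intro h
      apply hdet
      linear_combination h + M 0 1 * M 1 0 * hε) (hζ.algEquiv_comm σ τ _) hτ (by
      rw [map_mul σ, AlgEquiv.commutes, map_mul, map_mul]
      linear_combination algebraMap ℚ K ε * hσ + algebraMap ℚ K ε * algebraMap ℚ K (M 1 0) *
        (ζ + ζ⁻¹) * σ (ζ + ζ⁻¹) * hεK)
  exact ⟨(mul_eq_zero.1 ht).resolve_left hε0, (mul_eq_zero.1 hu).resolve_left hε0, hs⟩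

theorem diag_or_antidiag_of_mem_formAutAbs (hζ : IsPrimitiveRoot ζ n) (h4 : 4 ∣ n)
    (hdeg : 3 ≤ (minpoly ℚ (ζ + ζ⁻¹)).natDegree) {M : Matrix (Fin 2) (Fin 2) ℚ}
    (hM : M ∈ formAutAbs (psiForm n)) :
    (M 0 1 = 0 ∧ M 1 0 = 0 ∧ M 0 0 ≠ 0 ∧ M 1 1 ≠ 0) ∨
    (M 0 0 = 0 ∧ M 1 1 = 0 ∧ ∃ c : ℚ, c ≠ 0 ∧ ∃ σ : K ≃ₐ[ℚ] K,
      (ζ + ζ⁻¹) * σ (ζ + ζ⁻¹) = algebraMap ℚ K c) := by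
  obtain ⟨hdet, σ, hσ⟩ := exists_algEquiv_of_mem_formAutAbs hζ hdeg hM
  obtain ⟨τ, hτ⟩ := exists_algEquiv_neg hζ h4
  rcases moebius_diag_or_antidiag_of_comm_neg hdeg hdet (hζ.algEquiv_comm σ τ _) hτ hσ with
    ⟨h1, h2⟩ | ⟨h1, h2⟩
  · left
    rw [h1, zero_mul, sub_zero] at hdet
    exact ⟨h1, h2, left_ne_zero_of_mul hdet, right_ne_zero_of_mul hdet⟩
  · right
    rw [h1, zero_mul, zero_sub, neg_ne_zero] at hdet
    have ht : algebraMap ℚ K (M 1 0) ≠ 0 := by simpa using right_ne_zero_of_mul hdet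
    refine ⟨h1, h2, M 0 1 / M 1 0, div_ne_zero (left_ne_zero_of_mul hdet)
      (right_ne_zero_of_mul hdet), σ, ?_⟩
    rw [h1, h2, map_zero, add_zero, zero_mul, zero_add] at hσ
    rw [map_div₀, eq_div_iff ht]
    linear_combination hσ

theorem sq_ne_natCast_of_not_isSquare {k : ℕ} (hk : ¬ IsSquare k) (c : ℚ) : c ^ 2 ≠ k := by
  intro h
  exact hk (Rat.isSquare_natCast_iff.1 ⟨c, by rw [← h, pow_two]⟩)

theorem false_of_mul_conj_eq_algebraMap (hζ : IsPrimitiveRoot ζ n) (h4 : 4 ∣ n) (h24 : n ≠ 24)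
    (hdeg : 3 ≤ (minpoly ℚ (ζ + ζ⁻¹)).natDegree) {c : ℚ} (hc : c ≠ 0) {σ : K ≃ₐ[ℚ] K}
    (hσ : (ζ + ζ⁻¹) * σ (ζ + ζ⁻¹) = algebraMap ℚ K c) : False := by
  have hζ0 : ζ ≠ 0 := hζ.ne_zero (NeZero.ne n)
  have hn : 4 < n := by
    have h0 := NeZero.pos n
    by_contra hle
    obtain rfl : n = 4 := by
      obtain ⟨m, rfl⟩ := h4
      omega
    rw [hζ.natDegree_minpoly_add_inv (by norm_num)] at hdeg
    revert hdeg
    decide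
  have hd := hζ.natDegree_minpoly_add_inv (by omega)
  have heven := Nat.even_totient_div_two h4 hn
  have hsmall : ¬ 5 ≤ (minpoly ℚ (ζ + ζ⁻¹)).natDegree → n = 16 ∨ n = 20 := by
    intro h
    have : n.totient / 2 = 4 := by
      rw [hd] at h hdeg
      obtain ⟨k, hk⟩ := heven
      omega
    have := Nat.eq_of_totient_div_two_eq_four h4 this
    omega
  by_cases h8 : 8 ∣ n
  · obtain ⟨τ, hτ⟩ := exists_algEquiv_four_sub_sq hζ h8
    have h := inversion_comm_four_sub (hζ.algEquiv_comm σ τ _) hτ hσ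
    by_cases h5 : 5 ≤ (minpoly ℚ (ζ + ζ⁻¹)).natDegree
    · have := (quartic_coeffs_eq_zero h5 (a := 1) (b := 0) (c := -4) (e := 0) (f := c ^ 2) (by
        simp only [map_one, map_zero, map_neg, map_pow, map_ofNat]
        linear_combination h)).1
      norm_num at this
    · obtain rfl : n = 16 := by
        have := hsmall h5
        omega
      have h16 := add_inv_root_of_pow_eight
        (IsPrimitiveRoot.pow_eq_neg_one_of_two_mul (m := 8) hζ (by norm_num)) hζ0
      refine sq_ne_natCast_of_not_isSquare (k := 2) Nat.prime_two.prime.not_isSquare c ?_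
      apply (algebraMap ℚ K).injective
      rw [map_pow, map_natCast]
      push_cast
      linear_combination h - h16
  · obtain ⟨τ, hτ⟩ := exists_algEquiv_four_mul_sub hζ h4 h8
    have h := inversion_comm_four_mul_sub_sq hc (hζ.algEquiv_comm σ τ _) hτ hσ
    by_cases h5 : 5 ≤ (minpoly ℚ (ζ + ζ⁻¹)).natDegree
    · have := (quartic_coeffs_eq_zero h5 (a := 4) (b := 0) (c := -(15 + c ^ 2)) (e := 0)
        (f := 4 * c ^ 2) (by
          simp only [map_zero, map_neg, map_pow, map_ofNat, map_mul, map_add]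
          linear_combination h)).1
      norm_num at this
    · obtain rfl : n = 20 := by
        have := hsmall h5
        omega
      have h10 := IsPrimitiveRoot.pow_eq_neg_one_of_two_mul (m := 10) hζ (by norm_num)
      have h20 := add_inv_root_of_pow_ten h10 hζ0 (fun h2 =>
        hζ.pow_ne_one_of_pos_of_lt (l := 4) (by norm_num) (by norm_num) (by
          linear_combination (ζ ^ 2 - 1) * h2))
      have hlin := (quadratic_coeffs_eq_zero hdeg (a := 5 - c ^ 2) (b := 0) (c := 4 * c ^ 2 - 20)
        (by
          simp only [map_zero, map_sub, map_pow, map_ofNat, map_mul]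
          linear_combination h - 4 * h20)).1
      refine sq_ne_natCast_of_not_isSquare (k := 5) Nat.prime_five.prime.not_isSquare c ?_
      push_cast
      linear_combination -hlin

end Cyclotomic

theorem formAut_eq_of_odd {F : MvPolynomial (Fin 2) ℚ} {d : ℕ} (hF : F.IsHomogeneous d)
    (hF0 : F ≠ 0) (hd : Odd d) {T : Set (Matrix (Fin 2) (Fin 2) ℚ)}
    (h₁ : ∀ M ∈ formAutAbs F, M ∈ T ∨ -M ∈ T) (h₂ : ∀ M ∈ T, formSubst F M = F) :
    formAut F = T ∧ formAutAbs F = {M | M ∈ T ∨ -M ∈ T} := by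
  have hneg : ∀ M, -M ∈ T → formSubst F M = -F := fun M hM => by
    have h := hF.formSubst_neg (-M)
    rw [neg_neg, hd.neg_one_pow, h₂ _ hM, neg_one_mul] at h
    exact h
  refine ⟨Set.Subset.antisymm (fun M hM => ?_) fun M hM => h₂ M hM,
    Set.Subset.antisymm h₁ fun M hM => ?_⟩
  · refine (h₁ M (formAut_subset_formAutAbs F hM)).resolve_right fun h => hF0 ?_
    have h' := hneg M h
    rw [show formSubst F M = F from hM] at h'
    exact self_eq_neg.1 h'
  · exact hM.imp (h₂ M) (hneg M)

theorem formAut_eq_of_subset {F : MvPolynomial (Fin 2) ℚ} {T : Set (Matrix (Fin 2) (Fin 2) ℚ)}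
    (h₁ : ∀ M ∈ formAutAbs F, M ∈ T) (h₂ : ∀ M ∈ T, formSubst F M = F) :
    formAut F = T ∧ formAutAbs F = T :=
  ⟨Set.Subset.antisymm (fun M hM => h₁ M (formAut_subset_formAutAbs F hM)) h₂,
    Set.Subset.antisymm h₁ fun M hM => formAut_subset_formAutAbs F (h₂ M hM)⟩

section Cyclotomic

variable {n : ℕ} [NeZero n] {K : Type*} [Field K] [NumberField K]
  [IsCyclotomicExtension {n} ℚ K] {ζ : K}

theorem isHomogeneous_psiForm (n : ℕ) :
    (psiForm n).IsHomogeneous (psiPoly n).natDegree :=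
  isHomogeneous_homogenize _

theorem psiPoly_monic (hζ : IsPrimitiveRoot ζ n) : (psiPoly n).Monic := by
  rw [psiPoly_eq_minpoly hζ]
  exact minpoly.monic (Algebra.IsIntegral.isIntegral _)

theorem psiForm_ne_zero (hζ : IsPrimitiveRoot ζ n) : psiForm n ≠ 0 := fun h =>
  (psiPoly_monic hζ).ne_zero (eq_zero_of_homogenize_eq_zero le_rfl h)

theorem pow_eq_of_mem_formAutAbs (hζ : IsPrimitiveRoot ζ n) {M : Matrix (Fin 2) (Fin 2) ℚ}
    (hM : M ∈ formAutAbs (psiForm n)) (h10 : M 1 0 = 0) :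
    M 0 0 ^ (psiPoly n).natDegree = 1 ∨ M 0 0 ^ (psiPoly n).natDegree = -1 := by
  have h := mem_formAutAbs_aeval (A := ℚ) hM 1 0
  simp only [Algebra.algebraMap_self, RingHom.id_apply, mul_one, mul_zero, add_zero, h10] at h
  rwa [psiForm, aeval_homogenize_pair_zero (psiPoly_monic hζ),
    aeval_homogenize_pair_zero (psiPoly_monic hζ), one_pow] at h

theorem psiForm_aut_of_not_four_dvd (hζ : IsPrimitiveRoot ζ n) (h4 : ¬ 4 ∣ n)
    (hdeg : 5 ≤ (psiPoly n).natDegree) :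
    ∀ M ∈ formAutAbs (psiForm n), M = 1 ∨ M = -1 := by
  intro M hM
  obtain ⟨h10, h01, h00⟩ := scalar_of_mem_formAutAbs hζ h4
    (by rwa [← psiPoly_eq_minpoly hζ]) hM
  have hs := eq_one_or_eq_neg_one_of_pow (by omega) (pow_eq_of_mem_formAutAbs hζ hM h10)
  refine hs.imp (fun hs => ?_) fun hs => ?_ <;> ext i j <;> fin_cases i <;> fin_cases j <;>
    simp [h10, h01, ← h00, hs]

theorem formSubst_psiForm_neg_left (hζ : IsPrimitiveRoot ζ n) (h4 : 4 ∣ n)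
    (heven : Even (psiPoly n).natDegree) :
    formSubst (psiForm n) !![-1, 0; 0, 1] = psiForm n := by
  obtain ⟨τ, hτ⟩ := exists_algEquiv_neg hζ h4
  have hneg : (psiPoly n).comp (-X) = psiPoly n := by
    have h := minpoly.neg (A := ℚ) (ζ + ζ⁻¹)
    rw [← hτ, minpoly.algEquiv_eq, ← psiPoly_eq_minpoly hζ, heven.neg_one_pow, one_mul] at h
    exact h.symm
  refine formSubst_eq_iff.2 fun x y => ?_
  have hx : (![(!![-1, 0; 0, 1] : Matrix (Fin 2) (Fin 2) ℚ) 0 0 * x +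
      (!![-1, 0; 0, 1] : Matrix (Fin 2) (Fin 2) ℚ) 0 1 * y,
      (!![-1, 0; 0, 1] : Matrix (Fin 2) (Fin 2) ℚ) 1 0 * x +
      (!![-1, 0; 0, 1] : Matrix (Fin 2) (Fin 2) ℚ) 1 1 * y] : Fin 2 → ℚ) = ![-x, y] := by
    simp
  rw [hx, psiForm]
  by_cases hy : y = 0
  · rw [hy, aeval_homogenize_pair_zero (psiPoly_monic hζ),
      aeval_homogenize_pair_zero (psiPoly_monic hζ), heven.neg_pow]
  · rw [aeval_homogenize_pair _ hy, aeval_homogenize_pair _ hy]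
    congr 1
    conv_rhs => rw [← hneg]
    rw [aeval_comp, map_neg, aeval_X, neg_div]

theorem psiForm_aut_of_four_dvd (hζ : IsPrimitiveRoot ζ n) (h4 : 4 ∣ n) (h24 : n ≠ 24)
    (hdeg : 3 ≤ (psiPoly n).natDegree) (heven : Even (psiPoly n).natDegree) :
    formAut (psiForm n) = matrixGroup {!![-1, 0; 0, 1], !![1, 0; 0, -1]} ∧
      formAutAbs (psiForm n) = matrixGroup {!![-1, 0; 0, 1], !![1, 0; 0, -1]} := by
  rw [matrixGroup_diagonal_eq]
  have hdeg' : 3 ≤ (minpoly ℚ (ζ + ζ⁻¹)).natDegree := by rwa [← psiPoly_eq_minpoly hζ]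
  have hneg : ∀ M, formSubst (psiForm n) (-M) = formSubst (psiForm n) M := fun M => by
    rw [(isHomogeneous_psiForm n).formSubst_neg, heven.neg_one_pow, one_mul]
  have hflip := formSubst_psiForm_neg_left hζ h4 heven
  have hflip' : formSubst (psiForm n) !![1, 0; 0, -1] = psiForm n := by
    rw [show (!![1, 0; 0, -1] : Matrix (Fin 2) (Fin 2) ℚ) = -!![-1, 0; 0, 1] by simp, hneg, hflip]
  apply formAut_eq_of_subset
  · intro M hM
    rcases diag_or_antidiag_of_mem_formAutAbs hζ h4 hdeg' hM with
      ⟨h01, h10, h00, h11⟩ | ⟨-, -, c, hc, σ, hσ⟩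
    · have hs := eq_one_or_eq_neg_one_of_pow (by omega) (pow_eq_of_mem_formAutAbs hζ hM h10)
      have hv : M 1 1 = 1 ∨ M 1 1 = -1 := by
        have h := mem_formAutAbs_aeval (A := ℚ) hM 0 1
        simp only [Algebra.algebraMap_self, RingHom.id_apply, mul_one, mul_zero, zero_add,
          h01] at h
        rw [psiForm, aeval_homogenize_pair _ h11, aeval_homogenize_pair _ one_ne_zero, zero_div,
          zero_div, one_pow, one_mul] at h
        have h0 : aeval (0 : ℚ) (psiPoly n) ≠ 0 := by
          intro h0
          refine algebraMap_ne_of_aeval_minpoly hdeg' (β := algebraMap ℚ K 0) ?_ 0 rfl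
          rw [aeval_algebraMap_apply, ← psiPoly_eq_minpoly hζ, h0, map_zero]
        refine eq_one_or_eq_neg_one_of_pow (d := (psiPoly n).natDegree) (by omega) ?_
        refine h.imp (fun h => ?_) fun h => ?_
        · exact mul_right_cancel₀ h0 (by rw [h, one_mul])
        · exact mul_right_cancel₀ h0 (by rw [h, neg_one_mul])
      have hM' : M = !![M 0 0, 0; 0, M 1 1] := by
        ext i j
        fin_cases i <;> fin_cases j <;> simp [h01, h10]
      rw [hM']
      rcases hs with hs | hs <;> rcases hv with hv | hv <;> rw [hs, hv] <;> decide +kernel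
    · exact (false_of_mul_conj_eq_algebraMap hζ h4 h24 hdeg' hc hσ).elim
  · intro M hM
    simp only [Finset.coe_insert, Finset.coe_singleton] at hM
    rcases hM with rfl | rfl | rfl | rfl
    · exact one_mem_formAut _
    · exact hflip
    · exact hflip'
    · rw [hneg]
      exact one_mem_formAut _

theorem psiForm_aut_cubic (hζ : IsPrimitiveRoot ζ n) (hn : 2 < n) {ε a : ℚ}
    (hε : ε = 1 ∨ ε = -1) (htot : n.totient / 2 = 3)
    (hroot : (ζ + ζ⁻¹) ^ 3 + algebraMap ℚ K (ε * a) * (ζ + ζ⁻¹) ^ 2 +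
      algebraMap ℚ K (a - 3) * (ζ + ζ⁻¹) + algebraMap ℚ K (-ε) = 0) :
    formAut (psiForm n) = cubicAutMatrices ε ∧
      formAutAbs (psiForm n) = {M | M ∈ cubicAutMatrices ε ∨ -M ∈ cubicAutMatrices ε} := by
  have hα := minpoly_add_inv_eq hζ hn
    (q := X ^ 3 + C (ε * a) * X ^ 2 + C (a - 3) * X + C (-ε)) (by monicity!)
    (by rw [natDegree_cubic_monic, htot])
    (by simpa only [map_add, map_mul, map_pow, aeval_X, aeval_C] using hroot)
  have hF : psiForm n =
      (X ^ 3 + C (ε * a) * X ^ 2 + C (a - 3) * X + C (-ε) : ℚ[X]).homogenize 3 := by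
    rw [psiForm_eq_homogenize hζ, hα, natDegree_cubic_monic]
  refine formAut_eq_of_odd (d := 3) ?_ (psiForm_ne_zero hζ) (by decide) ?_ ?_
  · rw [hF]
    exact isHomogeneous_homogenize _
  · intro M hM
    rw [hF] at hM
    exact mem_cubicAutMatrices hε hα hM
  · intro M hM
    rw [hF]
    exact formSubst_cubic hε a hM

theorem psiForm_aut_quartic (hζ : IsPrimitiveRoot ζ n) (hn : 2 < n) {ε : ℚ}
    (hε : ε = 1 ∨ ε = -1) (htot : n.totient / 2 = 4)
    (hroot : (ζ + ζ⁻¹) ^ 4 + algebraMap ℚ K (-ε) * (ζ + ζ⁻¹) ^ 3 - 4 * (ζ + ζ⁻¹) ^ 2 +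
      algebraMap ℚ K (4 * ε) * (ζ + ζ⁻¹) + 1 = 0) :
    formAut (psiForm n) = quarticAutMatrices ε ∧
      formAutAbs (psiForm n) = quarticAutMatrices ε := by
  have hα := minpoly_add_inv_eq hζ hn
    (q := X ^ 4 + C (-ε) * X ^ 3 + C (-4) * X ^ 2 + C (4 * ε) * X + C 1) (by monicity!)
    (by rw [natDegree_quartic_monic, htot]) (by
      simp only [map_add, map_mul, map_pow, aeval_X, aeval_C, map_neg, map_ofNat,
        map_one] at hroot ⊢
      linear_combination hroot)
  have hF : psiForm n =
      (X ^ 4 + C (-ε) * X ^ 3 + C (-4) * X ^ 2 + C (4 * ε) * X + C 1 : ℚ[X]).homogenize 4 := by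
    rw [psiForm_eq_homogenize hζ, hα, natDegree_quartic_monic]
  refine formAut_eq_of_subset ?_ ?_
  · intro M hM
    rw [hF] at hM
    exact mem_quarticAutMatrices hε hα hM
  · intro M hM
    rw [hF]
    exact formSubst_quartic hε hM

theorem psiForm_aut_twenty_four [IsCyclotomicExtension {24} ℚ K] (hζ : IsPrimitiveRoot ζ 24) :
    formAut (psiForm 24) = groupD4 ∧ formAutAbs (psiForm 24) = groupD4 := by
  have htot : Nat.totient 24 / 2 = 4 := by decide
  have hα := minpoly_add_inv_eq hζ (by norm_num)
    (q := X ^ 4 + C 0 * X ^ 3 + C (-4) * X ^ 2 + C 0 * X + C 1) (by monicity!)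
    (by rw [natDegree_quartic_monic, htot]) (by
      have h12 := IsPrimitiveRoot.pow_eq_neg_one_of_two_mul (m := 12) hζ (by norm_num)
      have h := add_inv_root_of_pow_twelve h12 (hζ.ne_zero (by norm_num)) (fun h2 =>
        hζ.pow_ne_one_of_pos_of_lt (l := 8) (by norm_num) (by norm_num) (by
          linear_combination (ζ ^ 4 - 1) * h2))
      simp only [map_add, map_mul, map_pow, aeval_X, map_neg, map_ofNat, map_one, map_zero]
      linear_combination h)
  have hF : psiForm 24 =
      (X ^ 4 + C 0 * X ^ 3 + C (-4) * X ^ 2 + C 0 * X + C 1 : ℚ[X]).homogenize 4 := by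
    rw [psiForm_eq_homogenize hζ, hα, natDegree_quartic_monic]
  rw [groupD4_eq]
  refine formAut_eq_of_subset (fun M hM => ?_) fun M hM => ?_
  · have hM' := hM
    rw [hF] at hM'
    have hval1 := mem_formAutAbs_aeval (A := ℚ) hM' 1 0
    have hval2 := mem_formAutAbs_aeval (A := ℚ) hM' 0 1
    simp only [Algebra.algebraMap_self, RingHom.id_apply, aeval_homogenize_quartic, mul_one,
      mul_zero, zero_add, add_zero] at hval1 hval2
    rcases diag_or_antidiag_of_mem_formAutAbs hζ (by norm_num)
      (by rw [hα, natDegree_quartic_monic]; norm_num) hM with ⟨h01, h10, -⟩ | ⟨h00, h11, -⟩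
    · have hs : M 0 0 = 1 ∨ M 0 0 = -1 :=
        eq_one_or_eq_neg_one_of_pow (d := 4) (by norm_num) (by simpa [h10] using hval1)
      have hv : M 1 1 = 1 ∨ M 1 1 = -1 :=
        eq_one_or_eq_neg_one_of_pow (d := 4) (by norm_num) (by simpa [h01] using hval2)
      have hMe : M = !![M 0 0, 0; 0, M 1 1] := by
        ext i j
        fin_cases i <;> fin_cases j <;> simp [h01, h10]
      rw [hMe]
      rcases hs with hs | hs <;> rcases hv with hv | hv <;> rw [hs, hv] <;> decide +kernel
    · have ht : M 1 0 = 1 ∨ M 1 0 = -1 :=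
        eq_one_or_eq_neg_one_of_pow (d := 4) (by norm_num) (by simpa [h00] using hval1)
      have hu : M 0 1 = 1 ∨ M 0 1 = -1 :=
        eq_one_or_eq_neg_one_of_pow (d := 4) (by norm_num) (by simpa [h11] using hval2)
      have hMe : M = !![0, M 0 1; M 1 0, 0] := by
        ext i j
        fin_cases i <;> fin_cases j <;> simp [h00, h11]
      rw [hMe]
      rcases ht with ht | ht <;> rcases hu with hu | hu <;> rw [ht, hu] <;> decide +kernel
  · rw [hF]
    refine formSubst_eq_iff.2 fun x y => ?_
    rw [aeval_homogenize_quartic, aeval_homogenize_quartic]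
    simp only [Finset.coe_insert, Finset.coe_singleton] at hM
    rcases hM with rfl | rfl | rfl | rfl | rfl | rfl | rfl | rfl <;> simp <;> ring

end Cyclotomic

theorem cubicAutMatrices_one :
    cubicAutMatrices 1 = matrixGroup {!![-1, -1; 1, 0]} ∧
      {M | M ∈ cubicAutMatrices 1 ∨ -M ∈ cubicAutMatrices 1} =
        matrixGroup {!![-1, -1; 1, 0], !![-1, 0; 0, -1]} := by
  rw [matrixGroup_order_three_eq, matrixGroup_order_six_eq]
  constructor
  · simp [cubicAutMatrices]
  · ext M
    simp only [cubicAutMatrices, Set.mem_ofPred_eq, Set.mem_insert_iff, Set.mem_singleton_iff,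
      neg_eq_iff_eq_neg]
    simp
    tauto

theorem cubicAutMatrices_neg_one :
    cubicAutMatrices (-1) = matrixGroup {!![-1, 1; -1, 0]} ∧
      {M | M ∈ cubicAutMatrices (-1) ∨ -M ∈ cubicAutMatrices (-1)} =
        matrixGroup {!![-1, 1; -1, 0], !![-1, 0; 0, -1]} := by
  rw [matrixGroup_order_three_twist_eq, matrixGroup_order_six_twist_eq]
  constructor
  · simp [cubicAutMatrices]
  · ext M
    simp only [cubicAutMatrices, Set.mem_ofPred_eq, Set.mem_insert_iff, Set.mem_singleton_iff,
      neg_eq_iff_eq_neg]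
    simp
    tauto

theorem quarticAutMatrices_one : quarticAutMatrices 1 = matrixGroup {!![-1, 2; -1, 1]} := by
  rw [matrixGroup_order_four_eq]
  ext M
  simp [quarticAutMatrices]
  tauto

theorem quarticAutMatrices_neg_one : quarticAutMatrices (-1) = matrixGroup {!![1, 2; -1, -1]} := by
  rw [matrixGroup_order_four_twist_eq]
  ext M
  simp [quarticAutMatrices]
  tauto

theorem IsPrimitiveRoot.neg_pow_ne_one {K : Type*} [Field K] {ζ : K} {n : ℕ}
    (hζ : IsPrimitiveRoot ζ n) {k : ℕ} (hk : 0 < k) (hkn : 2 * k < n) : (-ζ) ^ k ≠ 1 := fun h =>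
  hζ.pow_ne_one_of_pos_of_lt (l := 2 * k) (by omega) hkn (by
    rw [pow_mul, ← neg_sq, ← pow_mul, mul_comm, pow_mul, h, one_pow])

/-- The cyclotomic field is a cyclotomic extension for its `ℚ`-algebra structure as a field of
characteristic zero. -/
instance isCyclotomicExtension_cyclotomicField_rat (n : ℕ) [NeZero n] :
    IsCyclotomicExtension {n} ℚ (CyclotomicField n ℚ) :=
  CyclotomicField.isCyclotomicExtension n ℚ

theorem psiForm_aut_seven_eighteen {n : ℕ} (h : n = 7 ∨ n = 18) :
    formAut (psiForm n) = matrixGroup {!![-1, -1; 1, 0]} ∧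
      formAutAbs (psiForm n) = matrixGroup {!![-1, -1; 1, 0], !![-1, 0; 0, -1]} := by
  rw [← cubicAutMatrices_one.1, ← cubicAutMatrices_one.2]
  rcases h with rfl | rfl
  · have hζ := IsCyclotomicExtension.zeta_spec 7 ℚ (CyclotomicField 7 ℚ)
    refine psiForm_aut_cubic hζ (by norm_num) (a := 1) (Or.inl rfl) (by decide) ?_
    have h := add_inv_root_of_pow_seven hζ.pow_eq_one (hζ.ne_one (by norm_num))
    norm_num
    linear_combination h
  · have hζ := IsCyclotomicExtension.zeta_spec 18 ℚ (CyclotomicField 18 ℚ)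
    refine psiForm_aut_cubic hζ (by norm_num) (a := 0) (Or.inl rfl) (by decide) ?_
    have h := add_inv_root_of_pow_nine
      (η := -IsCyclotomicExtension.zeta 18 ℚ (CyclotomicField 18 ℚ))
      (by rw [Odd.neg_pow (by decide),
        IsPrimitiveRoot.pow_eq_neg_one_of_two_mul (m := 9) hζ (by norm_num), neg_neg])
      (hζ.neg_pow_ne_one (by norm_num) (by norm_num))
    rw [inv_neg] at h
    norm_num
    linear_combination -h

theorem psiForm_aut_nine_fourteen {n : ℕ} (h : n = 9 ∨ n = 14) :
    formAut (psiForm n) = matrixGroup {!![-1, 1; -1, 0]} ∧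
      formAutAbs (psiForm n) = matrixGroup {!![-1, 1; -1, 0], !![-1, 0; 0, -1]} := by
  rw [← cubicAutMatrices_neg_one.1, ← cubicAutMatrices_neg_one.2]
  rcases h with rfl | rfl
  · have hζ := IsCyclotomicExtension.zeta_spec 9 ℚ (CyclotomicField 9 ℚ)
    refine psiForm_aut_cubic hζ (by norm_num) (a := 0) (Or.inr rfl) (by decide) ?_
    have h := add_inv_root_of_pow_nine hζ.pow_eq_one
      (hζ.pow_ne_one_of_pos_of_lt (by norm_num) (by norm_num))
    norm_num
    linear_combination h
  · have hζ := IsCyclotomicExtension.zeta_spec 14 ℚ (CyclotomicField 14 ℚ)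
    refine psiForm_aut_cubic hζ (by norm_num) (a := 1) (Or.inr rfl) (by decide) ?_
    have h := add_inv_root_of_pow_seven
      (η := -IsCyclotomicExtension.zeta 14 ℚ (CyclotomicField 14 ℚ))
      (by rw [Odd.neg_pow (by decide),
        IsPrimitiveRoot.pow_eq_neg_one_of_two_mul (m := 7) hζ (by norm_num), neg_neg])
      (by simpa using hζ.neg_pow_ne_one (k := 1) (by norm_num) (by norm_num))
    rw [inv_neg] at h
    norm_num
    linear_combination -h

theorem psiForm_aut_fifteen : formAut (psiForm 15) = matrixGroup {!![-1, 2; -1, 1]} ∧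
    formAutAbs (psiForm 15) = matrixGroup {!![-1, 2; -1, 1]} := by
  rw [← quarticAutMatrices_one]
  have hζ := IsCyclotomicExtension.zeta_spec 15 ℚ (CyclotomicField 15 ℚ)
  refine psiForm_aut_quartic hζ (by norm_num) (Or.inl rfl) (by decide) ?_
  have h := add_inv_root_of_pow_fifteen hζ.pow_eq_one
    (hζ.pow_ne_one_of_pos_of_lt (by norm_num) (by norm_num))
    (hζ.pow_ne_one_of_pos_of_lt (by norm_num) (by norm_num))
  norm_num
  linear_combination h

theorem psiForm_aut_thirty : formAut (psiForm 30) = matrixGroup {!![1, 2; -1, -1]} ∧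
    formAutAbs (psiForm 30) = matrixGroup {!![1, 2; -1, -1]} := by
  rw [← quarticAutMatrices_neg_one]
  have hζ := IsCyclotomicExtension.zeta_spec 30 ℚ (CyclotomicField 30 ℚ)
  refine psiForm_aut_quartic hζ (by norm_num) (Or.inr rfl) (by decide) ?_
  have h := add_inv_root_of_pow_fifteen
      (η := -IsCyclotomicExtension.zeta 30 ℚ (CyclotomicField 30 ℚ))
    (by rw [Odd.neg_pow (by decide),
      IsPrimitiveRoot.pow_eq_neg_one_of_two_mul (m := 15) hζ (by norm_num), neg_neg])
    (hζ.neg_pow_ne_one (by norm_num) (by norm_num))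
    (hζ.neg_pow_ne_one (by norm_num) (by norm_num))
  rw [inv_neg] at h
  norm_num
  linear_combination h

end PolynomialForms

theorem theorem1p1 (n d : ℕ) (hn : 0 < n)
    (hn' : n ∉ ({1, 2, 3, 4, 5, 6, 8, 10, 12} : Set ℕ)) (hd : d = Nat.totient n / 2) :
    ((psiPoly n).natDegree = d ∧ 3 ≤ d) ∧
    -- `d ≥ 5` odd
    (5 ≤ d → Odd d →
      (formAut (psiForm n) = {1} ∧ GLConjugate (formAut (psiForm n)) groupC1) ∧
      (formAutAbs (psiForm n) = {1, -1} ∧ GLConjugate (formAutAbs (psiForm n)) groupC2)) ∧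
    -- `d ≥ 6` even, `4 ∤ n`
    (6 ≤ d → Even d → ¬ 4 ∣ n →
      formAut (psiForm n) = formAutAbs (psiForm n) ∧
      formAutAbs (psiForm n) = {1, -1} ∧ GLConjugate (formAutAbs (psiForm n)) groupC2) ∧
    -- `4 ∣ n`, `n ≠ 24`
    (4 ∣ n → n ≠ 24 →
      formAut (psiForm n) = formAutAbs (psiForm n) ∧
      formAutAbs (psiForm n) = matrixGroup {!![-1, 0; 0, 1], !![1, 0; 0, -1]} ∧
      GLConjugate (formAutAbs (psiForm n)) groupD2) ∧
    -- the exceptional values of `n`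
    (n = 7 ∨ n = 18 →
      (formAut (psiForm n) = matrixGroup {!![-1, -1; 1, 0]} ∧
        GLConjugate (formAut (psiForm n)) groupC3) ∧
      (formAutAbs (psiForm n) = matrixGroup {!![-1, -1; 1, 0], !![-1, 0; 0, -1]} ∧
        GLConjugate (formAutAbs (psiForm n)) groupC6)) ∧
    (n = 9 ∨ n = 14 →
      (formAut (psiForm n) = matrixGroup {!![-1, 1; -1, 0]} ∧
        GLConjugate (formAut (psiForm n)) groupC3) ∧
      (formAutAbs (psiForm n) = matrixGroup {!![-1, 1; -1, 0], !![-1, 0; 0, -1]} ∧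
        GLConjugate (formAutAbs (psiForm n)) groupC6)) ∧
    (n = 15 →
      (formAut (psiForm n) = matrixGroup {!![-1, 2; -1, 1]} ∧
        GLConjugate (formAut (psiForm n)) groupC4) ∧
      (formAutAbs (psiForm n) = matrixGroup {!![-1, 2; -1, 1]} ∧
        GLConjugate (formAutAbs (psiForm n)) groupC4)) ∧
    (n = 24 →
      (formAut (psiForm n) = matrixGroup {!![0, 1; 1, 0], !![0, 1; -1, 0]} ∧
        GLConjugate (formAut (psiForm n)) groupD4) ∧
      (formAutAbs (psiForm n) = matrixGroup {!![0, 1; 1, 0], !![0, 1; -1, 0]} ∧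
        GLConjugate (formAutAbs (psiForm n)) groupD4)) ∧
    (n = 30 →
      (formAut (psiForm n) = matrixGroup {!![1, 2; -1, -1]} ∧
        GLConjugate (formAut (psiForm n)) groupC4) ∧
      (formAutAbs (psiForm n) = matrixGroup {!![1, 2; -1, -1]} ∧
        GLConjugate (formAutAbs (psiForm n)) groupC4)) := by
  have hn2 : 2 < n := by
    simp only [Set.mem_insert_iff, Set.mem_singleton_iff] at hn'
    omega
  have : NeZero n := ⟨hn.ne'⟩
  have hζ := IsCyclotomicExtension.zeta_spec n ℚ (CyclotomicField n ℚ)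
  have hdeg : (psiPoly n).natDegree = d := by
    rw [psiPoly_eq_minpoly hζ, hζ.natDegree_minpoly_add_inv hn2, hd]
  have hd3 : 3 ≤ d := hd ▸ Nat.three_le_totient_div_two hn hn'
  have heven : 4 ∣ n → Even d := fun h4 => by
    rw [hd]
    refine Nat.even_totient_div_two h4 ?_
    simp only [Set.mem_insert_iff, Set.mem_singleton_iff] at hn'
    omega
  have hC2 : ({1, -1} : Set (Matrix (Fin 2) (Fin 2) ℚ)) = groupC2 := by
    rw [groupC2_eq]
    simp
  refine ⟨⟨hdeg, hd3⟩, ?_, ?_, ?_, ?_, ?_, ?_, ?_, ?_⟩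
  · intro h5 hodd
    have h4 : ¬ 4 ∣ n := fun h4 => Nat.not_even_iff_odd.2 hodd (heven h4)
    have hall := psiForm_aut_of_not_four_dvd hζ h4 (hdeg ▸ h5)
    obtain ⟨h1, h2⟩ := formAut_eq_of_odd (T := {1}) (isHomogeneous_psiForm n) (psiForm_ne_zero hζ)
      (hdeg ▸ hodd) (fun M hM => (hall M hM).imp id fun h => by simp [h]) (by
        rintro M rfl
        exact one_mem_formAut _)
    have h2' : formAutAbs (psiForm n) = {1, -1} := by
      rw [h2]
      ext M
      simp [neg_eq_iff_eq_neg]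
    refine ⟨⟨h1, ?_⟩, h2', ?_⟩
    · rw [h1, groupC1_eq, Finset.coe_singleton]
      exact .refl _
    · rw [h2', hC2]
      exact .refl _
  · intro h6 hev h4
    have hall := psiForm_aut_of_not_four_dvd hζ h4 (by omega)
    obtain ⟨h1, h2⟩ := formAut_eq_of_subset (T := {1, -1}) hall (by
        rintro M (rfl | rfl)
        · exact one_mem_formAut _
        · rw [(isHomogeneous_psiForm n).formSubst_neg, hdeg, hev.neg_one_pow, one_mul]
          exact one_mem_formAut _)
    refine ⟨h1.trans h2.symm, h2, ?_⟩
    rw [h2, hC2]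
    exact .refl _
  · intro h4 h24
    obtain ⟨h1, h2⟩ := psiForm_aut_of_four_dvd hζ h4 h24 (hdeg ▸ hd3) (hdeg ▸ heven h4)
    exact ⟨h1.trans h2.symm, h2, h2 ▸ GLConjugate_diagonal⟩
  · intro h
    obtain ⟨h1, h2⟩ := psiForm_aut_seven_eighteen h
    exact ⟨⟨h1, h1 ▸ GLConjugate_order_three⟩, h2, h2 ▸ GLConjugate_order_six⟩
  · intro h
    obtain ⟨h1, h2⟩ := psiForm_aut_nine_fourteen h
    exact ⟨⟨h1, h1 ▸ GLConjugate_order_three_twist⟩, h2, h2 ▸ GLConjugate_order_six_twist⟩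
  · rintro rfl
    obtain ⟨h1, h2⟩ := psiForm_aut_fifteen
    exact ⟨⟨h1, h1 ▸ GLConjugate_order_four⟩, h2, h2 ▸ GLConjugate_order_four⟩
  · rintro rfl
    obtain ⟨h1, h2⟩ := psiForm_aut_twenty_four hζ
    exact ⟨⟨h1, h1 ▸ .refl _⟩, h2, h2 ▸ .refl _⟩
  · rintro rfl
    obtain ⟨h1, h2⟩ := psiForm_aut_thirty
    exact ⟨⟨h1, h1 ▸ GLConjugate_order_four_twist⟩, h2, h2 ▸ GLConjugate_order_four_twist⟩
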